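/- \textbf{Setting.} Let $T>0$, let $A,G,\Gamma,Q,H\in\mathbb R^{n\times n}$, $B\in\mathbb R^{n\times n_1}$, $D\in\mathbb R^{n\times n_2}$, $R\in\mathbb R^{n_1\times n_1}$, $\eta,m_0\in\mathbb R^n$, $\gamma>0$, with $Q\ge 0$, $H\ge 0$, $R>0$ symmetric. On a complete probability space let $W_1,\dots,W_N$ be independent $\mathbb R^{n_2}$-valued standard Brownian motions on $[0,T]$, and let $\{\mathcal F_t\}_{0\le t\le T}$ be their natural filtration completed with the null sets. $L^2_{\mathcal F}(0,T;\mathbb R^k)$ denotes the $\mathcal F_t$-progressively measurable processes $x$ with $\mathbb E\int_0^T|x(t)|^2dt<\infty$. Fix an agent $1\le i\le N$, a deterministic initial state $x_i(0)\in\mathbb R^n$, a control $u_i\in L^2_{\mathcal F}(0,T;\mathbb R^{n_1})$ and $\bar u\in C([0,T];\mathbb R^{n_1})$. For $f\in L^2(0,T;\mathbb R^n)$ let $(x_i,m_i)\in L^2_{\mathcal F}(0,T;\mathbb R^n)\times L^2(0,T;\mathbb R^n)$ be the solution of $$dx_i=(Ax_i+Bu_i+Gm_i+f)\,dt+D\,dW_i,\qquad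 \dot m_i=(A+G)m_i+B\bar u+f,\quad m_i(0)=m_0,$$ with the given $x_i(0)$, and put, with $|z|_Q^2=z^TQz$, $$\bar J_i(u_i,f)=\mathbb E\int_0^T\Big\{|x_i-(\Gamma m_i+\eta)|_Q^2+u_i^TRu_i-\tfrac1\gamma|f|^2\Big\}dt+\mathbb E\,x_i^T(T)Hx_i(T),$$ $$\bar J_i'(u_i,f)=\mathbb E\int_0^T\Big\{-|x_i-(\Gamma m_i+\eta)|_Q^2+\tfrac1\gamma|f|^2\Big\}dt-\mathbb E\,x_i^T(T)Hx_i(T).$$ All differential equations are understood in integrated form. Assumption (H1) with constant $\epsilon_0>0$: for every $g\in L^2(0,T;\mathbb R^n)$, with $z$ the solution of $\dot z=(A+G)z+g$, $z(0)=0$, $$\int_0^T\Big\{-z^T(I-\Gamma)^TQ(I-\Gamma)z+\tfrac1\gamma|g|^2\Big\}dt-z^T(T)Hz(T)\ \ge\ \epsilon_0\|g\|_{L^2}^2 .$$ \textbf{Theorem.} Assume (H1) with constant $\epsilon_0>0$. Then for every $f\in L^2(0,T;\mathbb R^n)$ the state equations have a unique solution $(x_i,m_i)$ ($x_i$ up to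 indistinguishability), and: (i) $f\mapsto \bar J_i'(u_i,f)$ is strictly convex and $f\mapsto\bar J_i(u_i,f)$ is strictly concave on $L^2(0,T;\mathbb R^n)$. They are coercive: there are constants $C,C'$ (not depending on $f$) with $$\bar J_i'(u_i,f)\ge\tfrac{\epsilon_0}{2}\|f\|_{L^2}^2-C,\qquad \bar J_i(u_i,f)\le C'-\tfrac{\epsilon_0}{2}\|f\|_{L^2}^2\qquad\text{for all } f.$$ There is an $\hat f\in L^2(0,T;\mathbb R^n)$ which is the unique minimizer of $\bar J_i'(u_i,\cdot)$ and the unique maximizer of $\bar J_i(u_i,\cdot)$. (ii) There is a unique solution $(x_i,m_i,p_i)\in L^2_{\mathcal F}(0,T;\mathbb R^n)\times L^2(0,T;\mathbb R^{2n})$ ($x_i$ up to indistinguishability) of $$\begin{cases}dx_i=(Ax_i+Bu_i+Gm_i+\gamma p_i)\,dt+D\,dW_i,\\ \dot m_i=(A+G)m_i+B\bar u+\gamma p_i,\\ \dot p_i=-(A+G)^Tp_i-(I-\Gamma)^TQ\,[\mathbb E x_i-(\Gamma m_i+\eta)],\end{cases}$$ with the given $x_i(0)$, $m_i(0)=m_0$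 and $p_i(T)=H\,\mathbb E x_i(T)$; and $\hat f=\gamma p_i$ almost everywhere on $[0,T]$. -/

import Mathlib

open MeasureTheory ProbabilityTheory Set Filter Topology
open scoped ENNReal

namespace RobustLQG

/-- Euclidean space `ℝᵏ`. -/
abbrev E (k : ℕ) : Type := EuclideanSpace ℝ (Fin k)

/-- The matrix-vector product `M v` for vectors of Euclidean spaces. -/
noncomputable abbrev mv {k l : ℕ} (M : Matrix (Fin k) (Fin l) ℝ) (v : E l) : E k :=
  Matrix.toEuclideanLin M v

/-- The quadratic form `zᵀ M z`, also written `|z|²_M`. -/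
noncomputable def qf {k : ℕ} (M : Matrix (Fin k) (Fin k) ℝ) (z : E k) : ℝ :=
  inner ℝ z (mv M z)

/-- The parameters `(A, B, G, D; Γ, η, Q, R, γ, H)` of the game, the horizon `T` and the limit
`m₀` of the empirical mean of the initial states, with the standing assumptions on them. -/
structure Params (n n₁ n₂ : ℕ) where
  T : ℝ
  T_pos : 0 < T
  A : Matrix (Fin n) (Fin n) ℝ
  B : Matrix (Fin n) (Fin n₁) ℝ
  G : Matrix (Fin n) (Fin n) ℝ
  D : Matrix (Fin n) (Fin n₂) ℝ
  Γ : Matrix (Fin n) (Fin n) ℝ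
  η : E n
  Q : Matrix (Fin n) (Fin n) ℝ
  R : Matrix (Fin n₁) (Fin n₁) ℝ
  H : Matrix (Fin n) (Fin n) ℝ
  γ : ℝ
  m₀ : E n
  Q_psd : Q.PosSemidef
  R_pd : R.PosDef
  H_psd : H.PosSemidef
  γ_pos : 0 < γ

/-- The time interval `[0, T]`. -/
abbrev Time (T : ℝ) : Type := Icc (0 : ℝ) T

/-- Lebesgue measure on `[0, T]`. -/
noncomputable abbrev leb (T : ℝ) : Measure (Time T) :=
  Measure.comap (fun t : Time T => (t : ℝ)) volume

/-- The terminal time `T` as an element of `[0, T]`. -/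
def Params.last {n n₁ n₂ : ℕ} (d : Params n n₁ n₂) : Time d.T :=
  ⟨d.T, right_mem_Icc.mpr d.T_pos.le⟩

/-- The Hilbert space `L²(0, T; ℝᵏ)`. -/
abbrev L2 (T : ℝ) (k : ℕ) : Type := Lp (E k) 2 (leb T)

section Stochastic

variable {Ω : Type*} [mΩ : MeasurableSpace Ω]

/-- `W` is an `ℝᵏ`-valued standard Brownian motion on `[0, T]`. -/
structure IsStandardBrownian {T : ℝ} {k : ℕ} (W : Time T → Ω → E k) (P : Measure Ω) : Prop where
  measurable : ∀ t, Measurable (W t)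
  zero : ∀ t : Time T, (t : ℝ) = 0 → ∀ᵐ ω ∂P, W t ω = 0
  indepIncrements : HasIndepIncrements W P
  law : ∀ s t : Time T, s ≤ t →
    HasLaw (fun ω => W t ω - W s ω) (multivariateGaussian 0 (((t : ℝ) - (s : ℝ)) • 1)) P
  continuous : ∀ᵐ ω ∂P, Continuous fun t => W t ω

/-- `W₁, …, W_N` are independent `ℝᵏ`-valued standard Brownian motions on `[0, T]`. -/
structure IsBrownianFamily {T : ℝ} {N k : ℕ} (W : Fin N → Time T → Ω → E k) (P : Measure Ω) :
    Prop where
  brownian : ∀ j, IsStandardBrownian (W j) P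
  indep : iIndepFun (fun j ω t => W j t ω) P

/-- The natural filtration of `(W₁, …, W_N)`, completed with the `P`-null sets. -/
def brownianFiltration {T : ℝ} {N k : ℕ} (W : Fin N → Time T → Ω → E k) (P : Measure Ω)
    [P.IsComplete] (hW : ∀ j t, Measurable (W j t)) : Filtration (Time T) mΩ where
  seq t := (⨆ (j : Fin N) (s : Time T) (_ : s ≤ t), MeasurableSpace.comap (W j s) inferInstance) ⊔
    MeasurableSpace.generateFrom {a : Set Ω | P a = 0}
  mono' _ _ h := by
    refine sup_le_sup_right ?_ _
    refine iSup_le fun j => iSup_le fun s => iSup_le fun hs => ?_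
    exact le_iSup_of_le j (le_iSup_of_le s (le_iSup_of_le (le_trans hs h) le_rfl))
  le' _ := sup_le
    (iSup_le fun j => iSup_le fun s => iSup_le fun _ => (hW j s).comap_le)
    (MeasurableSpace.generateFrom_le fun a ha => Measure.IsComplete.out' a ha)

/-- The process `x` belongs to `L²_𝓕(0, T; ℝᵏ)`: it is progressively measurable and
`𝔼 ∫₀ᵀ |x(t)|² dt < ∞`. -/
structure IsL2Process {T : ℝ} {k : ℕ} (𝓕 : Filtration (Time T) mΩ) (P : Measure Ω)
    (x : Time T → Ω → E k) : Prop where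
  progressive : IsStronglyProgressive 𝓕 x
  finite : ∫⁻ ω, (∫⁻ t, ‖x t ω‖ₑ ^ 2 ∂(leb T)) ∂P < ∞

variable {n n₁ n₂ : ℕ}

/-- `(x, m)` is a solution of the limiting model with control `u`, mean field input `ubar`,
disturbance `f`, Brownian motion `W` and initial state `x₀`:
`dx = (A x + B u + G m + f) dt + D dW`, `x(0) = x₀`, and
`dm/dt = (A + G) m + B ubar + f`, `m(0) = m₀`. -/
structure IsState (d : Params n n₁ n₂) (𝓕 : Filtration (Time d.T) mΩ) (P : Measure Ω)
    (W : Time d.T → Ω → E n₂) (x₀ : E n) (ubar : Time d.T → E n₁) (u : Time d.T → Ω → E n₁)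
    (f : Time d.T → E n) (x : Time d.T → Ω → E n) (m : Time d.T → E n) : Prop where
  x_mem : IsL2Process 𝓕 P x
  m_mem : MemLp m 2 (leb d.T)
  x_eq : ∀ᵐ ω ∂P, ∀ t, x t ω =
    x₀ + (∫ s in Iic t, (mv d.A (x s ω) + mv d.B (u s ω) + mv d.G (m s) + f s) ∂(leb d.T))
      + mv d.D (W t ω)
  m_eq : ∀ t, m t = d.m₀ + ∫ s in Iic t, (mv (d.A + d.G) (m s) + mv d.B (ubar s) + f s) ∂(leb d.T)

/-- The state pair `(x, m)` produced by the control `u` and the disturbance `f`. -/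
noncomputable def state (d : Params n n₁ n₂) (𝓕 : Filtration (Time d.T) mΩ) (P : Measure Ω)
    (W : Time d.T → Ω → E n₂) (x₀ : E n) (ubar : Time d.T → E n₁) (u : Time d.T → Ω → E n₁)
    (f : L2 d.T n) : (Time d.T → Ω → E n) × (Time d.T → E n) :=
  Classical.epsilon fun xm => IsState d 𝓕 P W x₀ ubar u f xm.1 xm.2

/-- The cost
`J(u, f) = 𝔼 ∫₀ᵀ {|x - (Γ m + η)|²_Q + uᵀ R u - γ⁻¹ |f|²} dt + 𝔼 x(T)ᵀ H x(T)`. -/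
noncomputable def J (d : Params n n₁ n₂) (𝓕 : Filtration (Time d.T) mΩ) (P : Measure Ω)
    (W : Time d.T → Ω → E n₂) (x₀ : E n) (ubar : Time d.T → E n₁) (u : Time d.T → Ω → E n₁)
    (f : L2 d.T n) : ℝ :=
  let xm := state d 𝓕 P W x₀ ubar u f
  (∫ ω, (∫ t, (qf d.Q (xm.1 t ω - (mv d.Γ (xm.2 t) + d.η)) + qf d.R (u t ω)
      - 1 / d.γ * ‖f t‖ ^ 2) ∂(leb d.T)) ∂P)
    + ∫ ω, qf d.H (xm.1 d.last ω) ∂P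

/-- The cost of the equivalent minimization problem for the disturbance,
`J'(u, f) = 𝔼 ∫₀ᵀ {-|x - (Γ m + η)|²_Q + γ⁻¹ |f|²} dt - 𝔼 x(T)ᵀ H x(T)`. -/
noncomputable def J' (d : Params n n₁ n₂) (𝓕 : Filtration (Time d.T) mΩ) (P : Measure Ω)
    (W : Time d.T → Ω → E n₂) (x₀ : E n) (ubar : Time d.T → E n₁) (u : Time d.T → Ω → E n₁)
    (f : L2 d.T n) : ℝ :=
  let xm := state d 𝓕 P W x₀ ubar u f
  (∫ ω, (∫ t, (-qf d.Q (xm.1 t ω - (mv d.Γ (xm.2 t) + d.η)) + 1 / d.γ * ‖f t‖ ^ 2)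
      ∂(leb d.T)) ∂P)
    - ∫ ω, qf d.H (xm.1 d.last ω) ∂P

/-- `(x, m, p)` is a solution of the forward-backward system
`dx = (A x + B u + G m + γ p) dt + D dW`, `x(0) = x₀`,
`dm/dt = (A + G) m + B ubar + γ p`, `m(0) = m₀`,
`dp/dt = -(A + G)ᵀ p - (I - Γ)ᵀ Q [𝔼 x - (Γ m + η)]`, `p(T) = H 𝔼 x(T)`
in `L²_𝓕(0, T; ℝⁿ) × L²(0, T; ℝ²ⁿ)`. -/
structure IsSolution (d : Params n n₁ n₂) (𝓕 : Filtration (Time d.T) mΩ) (P : Measure Ω)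
    (W : Time d.T → Ω → E n₂) (x₀ : E n) (ubar : Time d.T → E n₁) (u : Time d.T → Ω → E n₁)
    (x : Time d.T → Ω → E n) (m p : Time d.T → E n) : Prop where
  x_mem : IsL2Process 𝓕 P x
  m_mem : MemLp m 2 (leb d.T)
  p_mem : MemLp p 2 (leb d.T)
  x_eq : ∀ᵐ ω ∂P, ∀ t, x t ω = x₀
    + (∫ s in Iic t, (mv d.A (x s ω) + mv d.B (u s ω) + mv d.G (m s) + d.γ • p s) ∂(leb d.T))
    + mv d.D (W t ω)
  m_eq : ∀ t, m t = d.m₀ + ∫ s in Iic t, (mv (d.A + d.G) (m s) + mv d.B (ubar s) + d.γ • p s)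
    ∂(leb d.T)
  p_eq : ∀ t, p t = mv d.H (∫ ω, x d.last ω ∂P)
    + ∫ s in Ici t, (mv (d.A + d.G).transpose (p s)
        + mv ((1 - d.Γ).transpose * d.Q) ((∫ ω, x s ω ∂P) - (mv d.Γ (m s) + d.η))) ∂(leb d.T)

end Stochastic

variable {n n₁ n₂ : ℕ}

/-- `z` solves the auxiliary dynamics `dz/dt = (A + G) z + g`, `z(0) = 0`. -/
structure IsAuxState (d : Params n n₁ n₂) (g : L2 d.T n) (z : Time d.T → E n) : Prop where
  z_mem : MemLp z 2 (leb d.T)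
  z_eq : ∀ t, z t = ∫ s in Iic t, (mv (d.A + d.G) (z s) + g s) ∂(leb d.T)

/-- The auxiliary cost `J''(g) = ∫₀ᵀ {-zᵀ Qhat z + γ⁻¹ |g|²} dt - z(T)ᵀ H z(T)` along the
trajectory `z` driven by `g`, where `Qhat = (I - Γ)ᵀ Q (I - Γ)`. -/
noncomputable def J'' (d : Params n n₁ n₂) (g : L2 d.T n) (z : Time d.T → E n) : ℝ :=
  (∫ t, (-qf ((1 - d.Γ).transpose * d.Q * (1 - d.Γ)) (z t) + 1 / d.γ * ‖g t‖ ^ 2)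
    ∂(leb d.T))
    - qf d.H (z d.last)

/-- The uniform convexity condition (H1) with constant `ε₀`: the functional
`J''(g) - ε₀ ‖g‖²` is positive semi-definite on `L²(0, T; ℝⁿ)`. -/
def H1 (d : Params n n₁ n₂) (ε₀ : ℝ) : Prop :=
  0 < ε₀ ∧ ∀ (g : L2 d.T n) (z : Time d.T → E n), IsAuxState d g z → 0 ≤ J'' d g z - ε₀ * ‖g‖ ^ 2

end RobustLQG

/-! Replacing the disturbance 0 by `f` shifts both `x` and `m` by the same deterministic curve `z`,
with `z' = (A + G) z + f`, `z(0) = 0`: noise, control and `ubar` cancel, and the gap between the two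
shifts solves `w' = A w`, `w(0) = 0` (`IsState.diff`). The tracking error therefore moves by `(I -
Γ) z`, and `J'` is exactly quadratic in `f` (`exists_J'_quadratic`): `J'(f) = ⟪M f, f⟫ - 2 ⟪b, f⟫ +
c`. Here `M = hess d` is self-adjoint and `⟪M g, g⟫ = J''(g)`, so (H1) says precisely that `M` is
coercive with constant `ε₀`. Strict convexity and the lower bound follow, and Lax-Milgram gives the
unique minimizer as the solution of `M f = b`. Since `J + J'` does not depend on `f`, every claim on
`J` is a claim on `J'`.

The link with the forward-backward system is the duality `inner_dual` between `z` and an adjoint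
curve `p`. It represents the linear part of `J'` by the adjoint of the undisturbed state. Applied
along the state driven by `f`, it turns `M f = b` into `f = γ p` (`exists_isSolution`). For two
solutions of the system with `g = γ (p' - p)` it gives `⟪M g, g⟫ = 0`, whence uniqueness
(`IsSolution.unique`).

As `D` is constant, no stochastic integral is needed: `x - D W` solves an ordinary linear equation
path by path, handled by variation of constants with merely integrable forcing. -/

namespace RobustLQG

/-! ### Integral calculus on `[0, T]`: product rule and linear equations in integrated form. -/

section Calculus

variable {T : ℝ} {V X Y Z : Type*} [NormedAddCommGroup V] [NormedSpace ℝ V]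
  [NormedAddCommGroup X] [NormedSpace ℝ X] [NormedAddCommGroup Y] [NormedSpace ℝ Y]
  [NormedAddCommGroup Z] [NormedSpace ℝ Z]

theorem measurableEmbedding_time : MeasurableEmbedding (fun t : Time T => (t : ℝ)) :=
  MeasurableEmbedding.subtype_coe measurableSet_Icc

theorem map_leb : (leb T).map (fun t : Time T => (t : ℝ)) = volume.restrict (Icc 0 T) := by
  rw [leb, measurableEmbedding_time.map_comap, Subtype.range_coe]

instance isFiniteMeasure_leb : IsFiniteMeasure (leb T) where
  measure_univ_lt_top := by
    rw [leb, measurableEmbedding_time.comap_apply, image_univ, Subtype.range_coe]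
    exact measure_Icc_lt_top

instance noAtoms_leb : NullSingletonClass (leb T) where
  measure_singleton t := by
    rw [leb, measurableEmbedding_time.comap_apply]
    simp

theorem setIntegral_Iic_leb (g : ℝ → V) (t : Time T) :
    ∫ s in Iic t, g s ∂(leb T) = ∫ s in (0 : ℝ)..t, g s := by
  have h : Iic t = (fun t : Time T => (t : ℝ)) ⁻¹' Iic (t : ℝ) := rfl
  rw [intervalIntegral.integral_of_le t.2.1, ← integral_Icc_eq_integral_Ioc, h,
    ← measurableEmbedding_time.setIntegral_map, map_leb,
    Measure.restrict_restrict measurableSet_Iic]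
  congr 2
  ext s
  simp only [mem_inter_iff, mem_Iic, mem_Icc]
  exact ⟨fun h => ⟨h.2.1, h.1⟩, fun h => ⟨h.2, h.1, h.2.trans t.2.2⟩⟩

theorem continuous_primitive_leb {k : Time T → V} (hk : Integrable k (leb T)) :
    Continuous fun t => ∫ s in Iic t, k s ∂(leb T) := by
  simp_rw [← integral_indicator measurableSet_Iic]
  refine continuous_iff_continuousAt.2 fun t => ?_
  refine continuousAt_of_dominated (bound := fun s => ‖k s‖)
    (Eventually.of_forall fun s => hk.aestronglyMeasurable.indicator measurableSet_Iic)
    (Eventually.of_forall fun s => Eventually.of_forall fun r => norm_indicator_le_norm_self _ _)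
    hk.norm ?_
  have : ∀ᵐ s ∂(leb T), s ≠ t := by
    simp [ae_iff]
  filter_upwards [this] with s hs
  rcases lt_or_gt_of_ne hs with h | h
  · refine continuousAt_const.congr (f := fun _ => k s) ?_
    filter_upwards [Ioi_mem_nhds h] with r hr
    rw [indicator_of_mem]
    exact (mem_Ioi.1 hr).le
  · refine continuousAt_const.congr (f := fun _ => (0 : V)) ?_
    filter_upwards [Iio_mem_nhds h] with r hr
    rw [indicator_of_notMem]
    simpa using hr

omit [NormedSpace ℝ V] in
theorem integrable_leb_of_continuous {k : Time T → V} (hk : Continuous k) :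
    Integrable k (leb T) := by
  obtain ⟨C, hC⟩ := isCompact_univ.exists_bound_of_continuousOn hk.continuousOn
  exact Integrable.of_bound hk.aestronglyMeasurable C
    (Eventually.of_forall fun s => hC s (mem_univ s))

theorem bilin_integrable (β : X →L[ℝ] Y →L[ℝ] Z) {a : Time T → X} {v : Time T → Y}
    (ha : Integrable a (leb T)) (hv : Continuous v) :
    Integrable (fun s => β (a s) (v s)) (leb T) := by
  obtain ⟨C, hC⟩ := isCompact_univ.exists_bound_of_continuousOn hv.continuousOn
  refine Integrable.mono' ((ha.norm.const_mul ‖β‖).mul_const C)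
    (β.aestronglyMeasurable_comp₂ ha.aestronglyMeasurable hv.aestronglyMeasurable)
    (Eventually.of_forall fun s => (β.le_opNorm₂ _ _).trans ?_)
  gcongr
  exact hC s (mem_univ s)

/-- Fubini on the square `[0, t]²` cut along its diagonal: each triangle gives one of the two terms.
This yields integration by parts for densities that are only integrable. -/
theorem bilin_primitive_aux [CompleteSpace X] [CompleteSpace Y] [CompleteSpace Z]
    (β : X →L[ℝ] Y →L[ℝ] Z) {a : Time T → X} {b : Time T → Y}
    (ha : Integrable a (leb T)) (hb : Integrable b (leb T)) (t : Time T) :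
    β (∫ s in Iic t, a s ∂(leb T)) (∫ s in Iic t, b s ∂(leb T)) =
      ∫ s in Iic t, (β (a s) (∫ r in Iic s, b r ∂(leb T)) +
        β (∫ r in Iic s, a r ∂(leb T)) (b s)) ∂(leb T) := by
  set μ := leb T with hμ
  set ν := μ.restrict (Iic t) with hν
  have hF : Integrable (fun z : Time T × Time T => β (a z.1) (b z.2)) (ν.prod ν) :=
    ha.restrict.op_fst_snd (op := fun x y => β x y) (by fun_prop) ⟨‖β‖, β.le_opNorm₂⟩ hb.restrict
  have hm : MeasurableSet {z : Time T × Time T | z.2 ≤ z.1} :=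
    measurableSet_le measurable_snd measurable_fst
  have hm1 (s : Time T) (hs : s ∈ Iic t) : ν.restrict (Iic s) = μ.restrict (Iic s) := by
    rw [hν, Measure.restrict_restrict measurableSet_Iic, inter_eq_left.2 (Iic_subset_Iic.2 hs)]
  have h1 : ∫ z in {z : Time T × Time T | z.2 ≤ z.1}, β (a z.1) (b z.2) ∂(ν.prod ν) =
      ∫ s in Iic t, β (a s) (∫ r in Iic s, b r ∂μ) ∂μ := by
    rw [← integral_indicator hm, integral_prod _ (hF.indicator hm)]
    refine setIntegral_congr_fun measurableSet_Iic fun s hs => ?_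
    have : ∀ r, indicator {z : Time T × Time T | z.2 ≤ z.1} (fun z => β (a z.1) (b z.2)) (s, r) =
      indicator (Iic s) (fun r => β (a s) (b r)) r := fun r => by
        simp [indicator_apply]
    simp only [this]
    rw [integral_indicator measurableSet_Iic, hm1 s hs]
    exact (β (a s)).integral_comp_comm hb.restrict
  have h2 : ∫ z in {z : Time T × Time T | z.2 ≤ z.1}ᶜ, β (a z.1) (b z.2) ∂(ν.prod ν) =
      ∫ s in Iic t, β (∫ r in Iic s, a r ∂μ) (b s) ∂μ := by
    rw [← integral_indicator hm.compl, integral_prod_symm _ (hF.indicator hm.compl)]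
    refine setIntegral_congr_fun measurableSet_Iic fun s hs => ?_
    have : ∀ r, indicator {z : Time T × Time T | z.2 ≤ z.1}ᶜ (fun z => β (a z.1) (b z.2)) (r, s) =
      indicator (Iio s) (fun r => β.flip (b s) (a r)) r := fun r => by
        simp [indicator_apply]
    simp only [this]
    -- The open half of the square produces `Iio s`; without atoms it may be replaced by `Iic s`.
    rw [integral_indicator measurableSet_Iio, Measure.restrict_congr_set Iio_ae_eq_Iic, hm1 s hs]
    exact (β.flip (b s)).integral_comp_comm ha.restrict
  have h0 : β (∫ s in Iic t, a s ∂μ) (∫ s in Iic t, b s ∂μ) =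
      ∫ z, β (a z.1) (b z.2) ∂(ν.prod ν) := by
    rw [integral_prod _ hF]
    simp_rw [fun s => (β (a s)).integral_comp_comm (μ := ν) hb.restrict]
    exact ((β.flip (∫ s in Iic t, b s ∂μ)).integral_comp_comm ha.restrict).symm
  rw [h0, ← integral_add_compl hm hF, h1, h2, integral_add]
  · exact (bilin_integrable β ha (continuous_primitive_leb hb)).restrict
  · exact (bilin_integrable β.flip hb (continuous_primitive_leb ha)).restrict

theorem bilin_primitive [CompleteSpace X] [CompleteSpace Y] [CompleteSpace Z]
    (β : X →L[ℝ] Y →L[ℝ] Z) {a : Time T → X} {b : Time T → Y}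
    (ha : Integrable a (leb T)) (hb : Integrable b (leb T)) {u : Time T → X} {v : Time T → Y}
    {x : X} {y : Y} (hu : ∀ t, u t = x + ∫ s in Iic t, a s ∂(leb T))
    (hv : ∀ t, v t = y + ∫ s in Iic t, b s ∂(leb T)) (t : Time T) :
    β (u t) (v t) = β x y + ∫ s in Iic t, (β (a s) (v s) + β (u s) (b s)) ∂(leb T) := by
  have i1 := ((bilin_integrable β ha (continuous_primitive_leb hb))).restrict (s := Iic t)
  have i2 := ((bilin_integrable β.flip hb (continuous_primitive_leb ha))).restrict (s := Iic t)
  have e1 := (β.flip y).integral_comp_comm (ha.restrict (s := Iic t))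
  have e2 := (β x).integral_comp_comm (hb.restrict (s := Iic t))
  have j1 := (β.flip y).integrable_comp (ha.restrict (s := Iic t))
  have j2 := (β x).integrable_comp (hb.restrict (s := Iic t))
  have e3 := bilin_primitive_aux β ha hb t
  simp only [hu, hv, map_add, add_apply, ContinuousLinearMap.flip_apply]
    at *
  rw [integral_add i1 i2] at e3
  have e4 := integral_add (j1.add i1) (j2.add i2)
  simp only [Pi.add_apply] at e4
  rw [e4, integral_add j1 i1, integral_add j2 i2, e1, e2, e3]
  abel

/-- The exponential `exp (t L)` for `t ∈ [0, T]`. -/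
noncomputable def flow [CompleteSpace V] (L : V →L[ℝ] V) (t : Time T) : V →L[ℝ] V :=
  NormedSpace.exp ((t : ℝ) • L)

variable [CompleteSpace V]

theorem continuous_flow (L : V →L[ℝ] V) : Continuous (flow L : Time T → V →L[ℝ] V) := by
  let : NormedAlgebra ℚ (V →L[ℝ] V) := .restrictScalars ℚ ℝ _
  unfold flow
  exact NormedSpace.exp_continuous.comp (by fun_prop)

theorem flow_eq (L : V →L[ℝ] V) (t : Time T) :
    flow L t = 1 + ∫ s in Iic t, L * flow L s ∂(leb T) := by
  let : NormedAlgebra ℚ (V →L[ℝ] V) := .restrictScalars ℚ ℝ _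
  have h := intervalIntegral.integral_eq_sub_of_hasDerivAt (a := 0) (b := (t : ℝ))
    (fun s _ => hasDerivAt_exp_smul_const' (𝕂 := ℝ) L s)
    (Continuous.intervalIntegrable (continuous_const.mul
      (NormedSpace.exp_continuous.comp (by fun_prop))) _ _)
  unfold flow
  rw [setIntegral_Iic_leb (fun s : ℝ => L * NormedSpace.exp (s • L)), h]
  simp

/-- With `L` on the right, the term `L y` of an equation cancels against the integrating factor in
`eq_ode`; existence in `ode_eq` uses `L` on the left. -/
theorem flow_eq' (L : V →L[ℝ] V) (t : Time T) :
    flow L t = 1 + ∫ s in Iic t, flow L s * L ∂(leb T) := by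
  let : NormedAlgebra ℚ (V →L[ℝ] V) := .restrictScalars ℚ ℝ _
  have h := intervalIntegral.integral_eq_sub_of_hasDerivAt (a := 0) (b := (t : ℝ))
    (fun s _ => hasDerivAt_exp_smul_const (𝕂 := ℝ) L s)
    (Continuous.intervalIntegrable (Continuous.mul
      (NormedSpace.exp_continuous.comp (by fun_prop)) continuous_const) _ _)
  unfold flow
  rw [setIntegral_Iic_leb (fun s : ℝ => NormedSpace.exp (s • L) * L), h]
  simp

theorem flow_mul_flow_neg (L : V →L[ℝ] V) (t : Time T) : flow L t * flow (-L) t = 1 := by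
  let : NormedAlgebra ℚ (V →L[ℝ] V) := .restrictScalars ℚ ℝ _
  unfold flow
  rw [← NormedSpace.exp_add_of_commute]
  · simp
  · simp [Commute, SemiconjBy]

/-- The variation of constants formula for `dy/dt = L y + k`, `y(0) = y₀`. -/
noncomputable def ode (L : V →L[ℝ] V) (y₀ : V) (k : Time T → V) (t : Time T) : V :=
  flow L t (y₀ + ∫ s in Iic t, flow (-L) s (k s) ∂(leb T))

theorem integrable_flow_apply (L : V →L[ℝ] V) {k : Time T → V} (hk : Integrable k (leb T)) :
    Integrable (fun s => flow L s (k s)) (leb T) :=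
  bilin_integrable (ContinuousLinearMap.id ℝ (V →L[ℝ] V)).flip hk (continuous_flow L)

theorem continuous_ode (L : V →L[ℝ] V) (y₀ : V) {k : Time T → V} (hk : Integrable k (leb T)) :
    Continuous (ode L y₀ k) :=
  (continuous_flow L).clm_apply
    (continuous_const.add (continuous_primitive_leb (integrable_flow_apply _ hk)))

theorem ode_eq (L : V →L[ℝ] V) (y₀ : V) {k : Time T → V} (hk : Integrable k (leb T))
    (t : Time T) :
    ode L y₀ k t = y₀ + ∫ s in Iic t, (L (ode L y₀ k s) + k s) ∂(leb T) := by
  have h := bilin_primitive (ContinuousLinearMap.id ℝ (V →L[ℝ] V))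
    (integrable_leb_of_continuous (continuous_const.mul (continuous_flow L)))
    (integrable_flow_apply (-L) hk) (flow_eq L) (y := y₀) (fun _ => rfl) t
  refine h.trans ?_
  congr 1
  refine integral_congr_ae (Eventually.of_forall fun s => ?_)
  have : flow L s (flow (-L) s (k s)) = k s := DFunLike.congr_fun (flow_mul_flow_neg L s) (k s)
  simp only [ContinuousLinearMap.id_apply, this]
  rfl

/-- Integrating factor: by the product rule `flow (-L) t (y t)` has density `flow (-L) s (k s)`,
because the two terms containing `L y` cancel. -/
theorem eq_ode (L : V →L[ℝ] V) (y₀ : V) {k y : Time T → V} (hk : Integrable k (leb T))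
    (hi : Integrable y (leb T)) (hy : ∀ t, y t = y₀ + ∫ s in Iic t, (L (y s) + k s) ∂(leb T)) :
    y = ode L y₀ k := by
  funext t
  have h := bilin_primitive (ContinuousLinearMap.id ℝ (V →L[ℝ] V))
    (integrable_leb_of_continuous ((continuous_flow (-L)).mul continuous_const))
    ((L.integrable_comp hi).add hk) (flow_eq' (-L)) hy t
  have h2 : flow L t (flow (-L) t (y t)) = y t := DFunLike.congr_fun (flow_mul_flow_neg L t) (y t)
  rw [← h2, ode]
  congr 1
  refine h.trans ?_
  congr 1
  refine integral_congr_ae (Eventually.of_forall fun s => ?_)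
  simp

end Calculus

/-! ### Coercive quadratic functionals on a Hilbert space. -/

section Quadratic

variable {V : Type*} [NormedAddCommGroup V] [InnerProductSpace ℝ V]

theorem quadratic_combo (M : V →L[ℝ] V) (hM : ∀ f g, inner ℝ (M f) g = inner ℝ (M g) f) (b : V)
    (c : ℝ) {Φ : V → ℝ} (hΦ : ∀ f, Φ f = inner ℝ (M f) f - 2 * inner ℝ b f + c) (x y : V)
    {r s : ℝ} (hrs : r + s = 1) :
    Φ (r • x + s • y) = r * Φ x + s * Φ y - r * s * inner ℝ (M (x - y)) (x - y) := by
  obtain rfl : s = 1 - r := by linarith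
  simp only [hΦ, map_add, map_sub, map_smul, inner_add_left, inner_add_right, inner_sub_left,
    inner_sub_right, inner_smul_left, inner_smul_right, hM y x, conj_trivial]
  ring

theorem quadratic_strictConvexOn (M : V →L[ℝ] V)
    (hM : ∀ f g, inner ℝ (M f) g = inner ℝ (M g) f) (b : V)
    (c : ℝ) {Φ : V → ℝ} (hΦ : ∀ f, Φ f = inner ℝ (M f) f - 2 * inner ℝ b f + c) {ε : ℝ}
    (hε : 0 < ε) (hMε : ∀ f, ε * ‖f‖ ^ 2 ≤ inner ℝ (M f) f) : StrictConvexOn ℝ univ Φ := by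
  refine ⟨convex_univ, fun x _ y _ hxy r s hr hs hrs => ?_⟩
  rw [quadratic_combo M hM b c hΦ x y hrs, smul_eq_mul, smul_eq_mul]
  have h : 0 < inner ℝ (M (x - y)) (x - y) := by
    refine lt_of_lt_of_le ?_ (hMε _)
    have := norm_pos_iff.2 (sub_ne_zero.2 hxy)
    positivity
  have : 0 < r * s * inner ℝ (M (x - y)) (x - y) := by positivity
  linarith

theorem quadratic_coercive (M : V →L[ℝ] V) (b : V)
    (c : ℝ) {Φ : V → ℝ} (hΦ : ∀ f, Φ f = inner ℝ (M f) f - 2 * inner ℝ b f + c) {ε : ℝ}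
    (hε : 0 < ε) (hMε : ∀ f, ε * ‖f‖ ^ 2 ≤ inner ℝ (M f) f) :
    ∃ C : ℝ, ∀ f, ε / 2 * ‖f‖ ^ 2 - C ≤ Φ f := by
  -- Young's inequality spends half of `ε` on absorbing the linear term; the remainder is the square
  -- in `h4`.
  refine ⟨2 * ‖b‖ ^ 2 / ε - c, fun f => ?_⟩
  have h1 := hMε f
  have h2 := real_inner_le_norm b f
  have h3 : 2 * (‖b‖ * ‖f‖) ≤ ε / 2 * ‖f‖ ^ 2 + 2 * ‖b‖ ^ 2 / ε := by
    have h4 : ε / 2 * ‖f‖ ^ 2 + 2 * ‖b‖ ^ 2 / ε - 2 * (‖b‖ * ‖f‖) =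
        (ε * ‖f‖ - 2 * ‖b‖) ^ 2 / (2 * ε) := by
      field_simp
      ring
    have : 0 ≤ (ε * ‖f‖ - 2 * ‖b‖) ^ 2 / (2 * ε) := by positivity
    linarith
  rw [hΦ]
  linarith

/-- Lax-Milgram solves `M f₀ = b`, and expanding around `f₀` leaves `Φ f₀` plus a coercive form. The
Euler equation is kept in the conclusion because it is what becomes the forward-backward system. -/
theorem quadratic_exists_min [CompleteSpace V] (M : V →L[ℝ] V)
    (hM : ∀ f g, inner ℝ (M f) g = inner ℝ (M g) f) (b : V)
    (c : ℝ) {Φ : V → ℝ} (hΦ : ∀ f, Φ f = inner ℝ (M f) f - 2 * inner ℝ b f + c) {ε : ℝ}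
    (hε : 0 < ε) (hMε : ∀ f, ε * ‖f‖ ^ 2 ≤ inner ℝ (M f) f) :
    ∃ f₀, M f₀ = b ∧ ∀ f, IsMinOn Φ univ f ↔ f = f₀ := by
  let B : V →L[ℝ] V →L[ℝ] ℝ := (innerSL ℝ).comp M
  have hB : IsCoercive B := ⟨ε, hε, fun f => by
    have := hMε f
    simpa [B, sq, mul_assoc] using this⟩
  obtain ⟨f₀, hf₀⟩ := hB.continuousLinearEquivOfBilin.surjective b
  have hMf : M f₀ = b := by
    rw [← hf₀]
    refine ext_inner_right ℝ fun g => ?_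
    rw [hB.continuousLinearEquivOfBilin_apply]
    rfl
  have key (f : V) : Φ f = Φ f₀ + inner ℝ (M (f - f₀)) (f - f₀) := by
    simp only [hΦ, map_sub, inner_sub_left, inner_sub_right, hM f f₀, ← hMf]
    ring
  refine ⟨f₀, hMf, fun f => ⟨fun h => ?_, fun h => ?_⟩⟩
  · have h1 := isMinOn_iff.1 h f₀ (mem_univ _)
    rw [key f] at h1
    have h2 := hMε (f - f₀)
    have h3 : ‖f - f₀‖ ^ 2 ≤ 0 := by
      by_contra! h4
      have : 0 < ε * ‖f - f₀‖ ^ 2 := by positivity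
      linarith
    have h5 : ‖f - f₀‖ = 0 := by
      rw [← sq_eq_zero_iff]
      exact le_antisymm h3 (by positivity)
    exact sub_eq_zero.1 (norm_eq_zero.1 h5)
  · subst h
    refine isMinOn_iff.2 fun g _ => ?_
    rw [key g]
    have := hMε (g - f)
    have : 0 ≤ ε * ‖g - f‖ ^ 2 := by positivity
    linarith

end Quadratic

/-! ### Square-integral bounds for solutions of linear equations. -/

section Bounds

variable {T : ℝ} {V : Type*} [NormedAddCommGroup V] [NormedSpace ℝ V]

theorem sq_lintegral_le {α : Type*} [MeasurableSpace α] (μ : Measure α) {g : α → ℝ≥0∞}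
    (hg : AEMeasurable g μ) : (∫⁻ s, g s ∂μ) ^ 2 ≤ μ univ * ∫⁻ s, g s ^ 2 ∂μ := by
  have h := ENNReal.lintegral_mul_le_Lp_mul_Lq μ Real.HolderConjugate.two_two
    (aemeasurable_const (b := (1 : ℝ≥0∞))) hg
  simp only [Pi.mul_apply, one_mul, ENNReal.one_rpow, lintegral_const] at h
  calc (∫⁻ s, g s ∂μ) ^ 2
      ≤ (μ univ ^ (1 / 2 : ℝ) * (∫⁻ s, g s ^ (2 : ℝ) ∂μ) ^ (1 / 2 : ℝ)) ^ 2 := by gcongr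
    _ = _ := by
      rw [mul_pow, ← ENNReal.rpow_natCast, ← ENNReal.rpow_natCast, ← ENNReal.rpow_mul,
        ← ENNReal.rpow_mul]
      simp

theorem enorm_sq_setIntegral_le {k : Time T → V} (hk : AEStronglyMeasurable k (leb T))
    (t : Time T) : ‖∫ s in Iic t, k s ∂(leb T)‖ₑ ^ 2 ≤
      leb T univ * ∫⁻ s, ‖k s‖ₑ ^ 2 ∂(leb T) := by
  refine le_trans ?_ (sq_lintegral_le (leb T) hk.enorm)
  gcongr
  exact (enorm_integral_le_lintegral_enorm _).trans
    (lintegral_mono' Measure.restrict_le_self le_rfl)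

omit [NormedSpace ℝ V] in
theorem enorm_add_sq_le (x y : V) : ‖x + y‖ₑ ^ 2 ≤ 2 * (‖x‖ₑ ^ 2 + ‖y‖ₑ ^ 2) := by
  have h : ‖x + y‖ₑ ^ 2 ≤ (‖x‖ₑ + ‖y‖ₑ) ^ 2 := by
    gcongr
    exact enorm_add_le x y
  refine h.trans ?_
  have h2 := ENNReal.rpow_add_le_mul_rpow_add_rpow ‖x‖ₑ ‖y‖ₑ (p := 2) (by norm_num)
  norm_num at h2
  exact_mod_cast h2

theorem exists_flow_bound [CompleteSpace V] (L : V →L[ℝ] V) :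
    ∃ C : NNReal, ∀ (t : Time T) (v : V), ‖flow L t v‖ₑ ≤ C * ‖v‖ₑ := by
  obtain ⟨C, hC⟩ := isCompact_univ.exists_bound_of_continuousOn
    (continuous_flow (T := T) L).continuousOn
  refine ⟨C.toNNReal, fun t v => ?_⟩
  have h : ‖flow L t v‖ ≤ C.toNNReal * ‖v‖ := by
    refine ((flow L t).le_opNorm v).trans ?_
    gcongr
    exact (hC t (mem_univ t)).trans (Real.le_coe_toNNReal C)
  have h2 : ‖flow L t v‖₊ ≤ C.toNNReal * ‖v‖₊ := h
  rw [enorm_eq_nnnorm, enorm_eq_nnnorm]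
  exact_mod_cast h2

/-- The constant depends only on `T` and `L`. It can thus be integrated over all paths of a random
forcing, and it also bounds the input-to-trajectory operator. -/
theorem exists_ode_bound [CompleteSpace V] (T : ℝ) (L : V →L[ℝ] V) :
    ∃ C : NNReal, ∀ (y₀ : V) (k : Time T → V) (_ : AEStronglyMeasurable k (leb T)) (t : Time T),
      ‖ode L y₀ k t‖ₑ ^ 2 ≤ C * (‖y₀‖ₑ ^ 2 + ∫⁻ s, ‖k s‖ₑ ^ 2 ∂(leb T)) := by
  obtain ⟨C₁, h₁⟩ := exists_flow_bound (T := T) L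
  obtain ⟨C₂, h₂⟩ := exists_flow_bound (T := T) (-L)
  obtain ⟨C₀, h₀⟩ : ∃ C : NNReal, leb T univ = C :=
    ⟨(leb T univ).toNNReal, (ENNReal.coe_toNNReal (measure_ne_top _ _)).symm⟩
  refine ⟨C₁ ^ 2 * (2 * (1 + C₀ * C₂ ^ 2)), fun y₀ k hk t => ?_⟩
  have hm : AEStronglyMeasurable (fun s => flow (-L) s (k s)) (leb T) :=
    (ContinuousLinearMap.id ℝ (V →L[ℝ] V)).aestronglyMeasurable_comp₂
      (continuous_flow (-L)).aestronglyMeasurable hk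
  set a := ‖y₀‖ₑ ^ 2
  set b := ∫⁻ s, ‖k s‖ₑ ^ 2 ∂(leb T)
  have e1 : ∫⁻ s, ‖flow (-L) s (k s)‖ₑ ^ 2 ∂(leb T) ≤ C₂ ^ 2 * b := by
    rw [← lintegral_const_mul' _ _ (by simp)]
    refine lintegral_mono fun s => ?_
    rw [← mul_pow]
    gcongr
    exact h₂ s _
  have e2 := (enorm_sq_setIntegral_le hm t).trans (mul_le_mul_right e1 _)
  calc ‖ode L y₀ k t‖ₑ ^ 2
      ≤ (C₁ * ‖y₀ + ∫ s in Iic t, flow (-L) s (k s) ∂(leb T)‖ₑ) ^ 2 := by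
        gcongr
        exact h₁ t _
    _ ≤ C₁ ^ 2 * (2 * (a + leb T univ * (C₂ ^ 2 * b))) := by
        rw [mul_pow]
        gcongr
        refine (enorm_add_sq_le _ _).trans ?_
        gcongr
    _ ≤ C₁ ^ 2 * (2 * ((a + b) + C₀ * (C₂ ^ 2 * (a + b)))) := by
        rw [h₀]
        gcongr
        · exact le_self_add
        · exact le_add_self
    _ = _ := by
        push_cast
        ring

theorem enorm_sq_L2 {k : ℕ} (f : L2 T k) : ‖f‖ₑ ^ 2 = ∫⁻ s, ‖f s‖ₑ ^ 2 ∂(leb T) := by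
  have := eLpNorm_nnreal_pow_eq_lintegral (μ := leb T) (f := f) (p := 2) (by norm_num)
  rw [Lp.enorm_def]
  simpa using this

omit [NormedSpace ℝ V] in
theorem integrable_of_memLp_two {k : Time T → V} (hk : MemLp k 2 (leb T)) :
    Integrable k (leb T) := hk.integrable (by norm_num)

theorem integrable_L2 {k : ℕ} (f : L2 T k) : Integrable f (leb T) :=
  integrable_of_memLp_two (Lp.memLp f)

end Bounds

/-! ### Matrices as operators and quadratic forms. -/

section Matrices

variable {k l m : ℕ}

/-- The continuous linear map `v ↦ M v`. -/
noncomputable def mvL (M : Matrix (Fin k) (Fin l) ℝ) : E l →L[ℝ] E k :=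
  LinearMap.toContinuousLinearMap (Matrix.toEuclideanLin M)

theorem mvL_apply (M : Matrix (Fin k) (Fin l) ℝ) (v : E l) : mvL M v = mv M v := rfl

theorem continuous_mv (M : Matrix (Fin k) (Fin l) ℝ) : Continuous fun v => mv M v :=
  (mvL M).continuous

theorem mv_mul (M : Matrix (Fin k) (Fin l) ℝ) (N : Matrix (Fin l) (Fin m) ℝ) (v : E m) :
    mv (M * N) v = mv M (mv N v) :=
  DFunLike.congr_fun (Matrix.toLpLin_mul_same 2 M N) v

theorem inner_mv_transpose (M : Matrix (Fin k) (Fin l) ℝ) (v : E l) (w : E k) :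
    inner ℝ (mv M.transpose w) v = inner ℝ w (mv M v) := by
  have : M.transpose = M.conjTranspose := by simp
  rw [this, mv, Matrix.toEuclideanLin_conjTranspose_eq_adjoint, LinearMap.adjoint_inner_left]

theorem inner_mv_comm {M : Matrix (Fin k) (Fin k) ℝ} (hM : M.PosSemidef) (v w : E k) :
    inner ℝ (mv M w) v = inner ℝ w (mv M v) := by
  have : M.transpose = M := by simpa [Matrix.IsHermitian] using hM.isHermitian
  rw [← inner_mv_transpose, this]

theorem qf_add {M : Matrix (Fin k) (Fin k) ℝ} (hM : M.PosSemidef) (v w : E k) :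
    qf M (v + w) = qf M v + 2 * inner ℝ w (mv M v) + qf M w := by
  have h := inner_mv_comm hM w v
  rw [real_inner_comm] at h
  simp only [qf, map_add, inner_add_left, inner_add_right, h]
  ring

theorem qf_sandwich (M N : Matrix (Fin k) (Fin k) ℝ) (z : E k) :
    qf (N.transpose * M * N) z = qf M (mv N z) := by
  rw [qf, qf, mul_assoc, mv_mul, mv_mul, real_inner_comm, inner_mv_transpose, real_inner_comm]

end Matrices

/-! ### Backward equations and their duality with forward ones. -/

section Dual

/-- The inner product of `ℝᵏ` as a bounded bilinear map. -/
noncomputable def innerB (k : ℕ) : E k →L[ℝ] E k →L[ℝ] ℝ := innerSL ℝ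

theorem innerB_apply {k : ℕ} (v w : E k) : innerB k v w = inner ℝ v w := rfl

theorem mv_add {k l : ℕ} (M : Matrix (Fin k) (Fin l) ℝ) (v w : E l) :
    mv M (v + w) = mv M v + mv M w := (mvL M).map_add v w

theorem mv_zero {k l : ℕ} (M : Matrix (Fin k) (Fin l) ℝ) : mv M 0 = 0 := (mvL M).map_zero

theorem mv_sub {k l : ℕ} (M : Matrix (Fin k) (Fin l) ℝ) (v w : E l) :
    mv M (v - w) = mv M v - mv M w := (mvL M).map_sub v w

theorem mv_smul {k l : ℕ} (M : Matrix (Fin k) (Fin l) ℝ) (c : ℝ) (v : E l) :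
    mv M (c • v) = c • mv M v := (mvL M).map_smul c v

variable {T : ℝ} {k : ℕ}

theorem setIntegral_Ici_leb {V : Type*} [NormedAddCommGroup V] [NormedSpace ℝ V]
    {h : Time T → V} (hh : Integrable h (leb T)) (t : Time T) :
    ∫ s in Ici t, h s ∂(leb T) = ∫ s, h s ∂(leb T) - ∫ s in Iic t, h s ∂(leb T) := by
  rw [← integral_add_compl (measurableSet_Iic (a := t)) hh, compl_Iic,
    Measure.restrict_congr_set Ioi_ae_eq_Ici]
  abel

/-- Rewrites the terminal value problem as an initial value problem, the form required by
`bilin_primitive`. -/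
theorem dual_forward {F : Matrix (Fin k) (Fin k) ℝ} {p h : Time T → E k} {pT : E k}
    (hp : Integrable p (leb T)) (hh : Integrable h (leb T))
    (hpe : ∀ t, p t = pT + ∫ s in Ici t, (mv F.transpose (p s) + h s) ∂(leb T)) (t : Time T) :
    p t = (pT + ∫ s, (mv F.transpose (p s) + h s) ∂(leb T)) +
      ∫ s in Iic t, -(mv F.transpose (p s) + h s) ∂(leb T) := by
  have ii : Integrable (fun s => mv F.transpose (p s) + h s) (leb T) :=
    ((mvL F.transpose).integrable_comp hp).add hh
  rw [hpe, setIntegral_Ici_leb ii, integral_neg]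
  abel

/-- Integrate the derivative of `⟪z, p⟫` over `[0, T]`: the terms with `F` and `Fᵀ` cancel, and
`z(0) = 0` kills the initial boundary term. -/
theorem inner_dual {F : Matrix (Fin k) (Fin k) ℝ} {p h z g : Time T → E k} {pT : E k}
    {e : Time T} (he : ∀ t, t ≤ e)
    (hp : Continuous p) (hh : Integrable h (leb T)) (hz : Continuous z)
    (hg : Integrable g (leb T))
    (hpe : ∀ t, p t = pT + ∫ s in Ici t, (mv F.transpose (p s) + h s) ∂(leb T))
    (hze : ∀ t, z t = ∫ s in Iic t, (mv F (z s) + g s) ∂(leb T)) :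
    inner ℝ (z e) pT + ∫ s, inner ℝ (z s) (h s) ∂(leb T) = ∫ s, inner ℝ (g s) (p s) ∂(leb T) := by
  have ip := integrable_leb_of_continuous hp
  have iz := integrable_leb_of_continuous hz
  have hIic : Iic e = univ := eq_univ_of_forall he
  have hpT : p e = pT := by
    rw [dual_forward ip hh hpe, hIic, setIntegral_univ, integral_neg]
    abel
  have key := bilin_primitive (innerB k)
    (((mvL F).integrable_comp iz).add hg)
    ((((mvL F.transpose).integrable_comp ip).add hh).neg) (x := 0)
    (fun t => (hze t).trans (zero_add _).symm) (dual_forward ip hh hpe) e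
  have i1 : Integrable (fun s => inner ℝ (g s) (p s)) (leb T) :=
    bilin_integrable (innerB k) hg hp
  have i2 : Integrable (fun s => inner ℝ (z s) (h s)) (leb T) := by
    simp_rw [real_inner_comm (h _)]
    exact bilin_integrable (innerB k) hh hz
  rw [hIic, setIntegral_univ, hpT] at key
  have h3 : ∀ s, inner ℝ (z s) (mv F.transpose (p s)) = inner ℝ (mv F (z s)) (p s) := fun s => by
    rw [real_inner_comm, inner_mv_transpose, real_inner_comm]
  simp only [Pi.add_apply, Pi.neg_apply, mvL_apply, innerB_apply, inner_zero_left, zero_add,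
    inner_add_left, inner_neg_right, inner_add_right, h3] at key
  have h4 : ∀ s, inner ℝ (mv F (z s)) (p s) + inner ℝ (g s) (p s) +
      -(inner ℝ (mv F (z s)) (p s) + inner ℝ (z s) (h s)) =
      inner ℝ (g s) (p s) - inner ℝ (z s) (h s) := fun s => by ring
  simp_rw [h4] at key
  rw [key, integral_sub i1 i2]
  abel

/-- The solution of the backward equation `dp/dt = -Fᵀ p - h`, `p(T) = pT`. -/
theorem exists_dual (F : Matrix (Fin k) (Fin k) ℝ) {h : Time T → E k} (pT : E k)
    {e : Time T} (he : ∀ t, t ≤ e) (hh : Integrable h (leb T)) :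
    ∃ p : Time T → E k, Continuous p ∧
      ∀ t, p t = pT + ∫ s in Ici t, (mv F.transpose (p s) + h s) ∂(leb T) := by
  have hIic : Iic e = univ := eq_univ_of_forall he
  set L := -mvL F.transpose with hL
  -- The initial value is the terminal condition transported back to time 0, so that `p e = pT` by
  -- construction.
  set p := ode L (flow (-L) e pT + ∫ s, flow (-L) s (h s) ∂(leb T)) (-h) with hp
  have hc : Continuous p := continuous_ode L _ hh.neg
  refine ⟨p, hc, fun t => ?_⟩
  have h1 := ode_eq L (flow (-L) e pT + ∫ s, flow (-L) s (h s) ∂(leb T)) hh.neg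
  rw [← hp] at h1
  have h2 : p e = pT := by
    rw [hp, ode, hIic, setIntegral_univ]
    simp only [Pi.neg_apply, map_neg, integral_neg, add_neg_cancel_right]
    exact DFunLike.congr_fun (flow_mul_flow_neg L e) pT
  have h3 := h1 e
  rw [h2, hIic, setIntegral_univ] at h3
  have ii := ((mvL F.transpose).integrable_comp (integrable_leb_of_continuous hc)).add hh
  have h4 : ∀ s, L (p s) + (-h) s = -(mv F.transpose (p s) + h s) := fun s => by
    rw [hL, neg_add]
    rfl
  simp_rw [h4, integral_neg] at h3 h1
  have h5 := setIntegral_Ici_leb ii t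
  simp only [Pi.add_apply, mvL_apply] at h5
  rw [h5, h3, h1]
  abel

end Dual

/-! ### The deterministic auxiliary system and the Hessian of the cost. -/

section Aux

variable {n n₁ n₂ : ℕ} (d : Params n n₁ n₂)

theorem Params.le_last (t : Time d.T) : t ≤ d.last := t.2.2

/-- The solution of `dz/dt = (A + G) z + g`, `z(0) = 0`. -/
noncomputable def auxState (g : L2 d.T n) : Time d.T → E n := ode (mvL (d.A + d.G)) 0 g

theorem continuous_auxState (g : L2 d.T n) : Continuous (auxState d g) :=
  continuous_ode _ _ (integrable_L2 g)

theorem auxState_eq (g : L2 d.T n) (t : Time d.T) :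
    auxState d g t = ∫ s in Iic t, (mv (d.A + d.G) (auxState d g s) + g s) ∂(leb d.T) := by
  refine (ode_eq (mvL (d.A + d.G)) 0 (integrable_L2 g) t).trans ?_
  rw [zero_add]
  rfl

theorem memLp_of_continuous {T : ℝ} {V : Type*} [NormedAddCommGroup V] {z : Time T → V}
    (hz : Continuous z) : MemLp z 2 (leb T) := by
  obtain ⟨C, hC⟩ := isCompact_univ.exists_bound_of_continuousOn hz.continuousOn
  exact MemLp.of_bound hz.aestronglyMeasurable C (Eventually.of_forall fun s => hC s (mem_univ s))

theorem isAuxState_auxState (g : L2 d.T n) : IsAuxState d g (auxState d g) :=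
  ⟨memLp_of_continuous (continuous_auxState d g), auxState_eq d g⟩

/-- The input is allowed to agree with `g` only almost everywhere, since sums and multiples in `L²`
have pointwise formulas only almost everywhere. -/
theorem eq_auxState {g : L2 d.T n} {z : Time d.T → E n} (hi : Integrable z (leb d.T))
    {g' : Time d.T → E n} (hg : g' =ᵐ[leb d.T] g)
    (hz : ∀ t, z t = ∫ s in Iic t, (mv (d.A + d.G) (z s) + g' s) ∂(leb d.T)) :
    z = auxState d g := by
  refine eq_ode _ _ (integrable_L2 g) hi fun t => ?_
  rw [zero_add, hz]
  refine integral_congr_ae (ae_restrict_of_ae ?_)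
  filter_upwards [hg] with s hs
  rw [hs, mvL_apply]

theorem auxState_add (f g : L2 d.T n) : auxState d (f + g) = auxState d f + auxState d g := by
  refine (eq_auxState d (integrable_leb_of_continuous
    ((continuous_auxState d f).add (continuous_auxState d g))) (Lp.coeFn_add f g).symm
    fun t => ?_).symm
  rw [Pi.add_apply, auxState_eq d f, auxState_eq d g, ← integral_add]
  · refine integral_congr_ae (Eventually.of_forall fun s => ?_)
    simp only [Pi.add_apply, mv_add _ (auxState d f s)]
    abel
  all_goals
    exact (((mvL (d.A + d.G)).integrable_comp
      (integrable_leb_of_continuous (continuous_auxState d _))).add (integrable_L2 _)).restrict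

theorem auxState_smul (c : ℝ) (f : L2 d.T n) : auxState d (c • f) = c • auxState d f := by
  refine (eq_auxState d (integrable_leb_of_continuous
    ((continuous_auxState d f).const_smul c)) (Lp.coeFn_smul c f).symm fun t => ?_).symm
  rw [Pi.smul_apply, auxState_eq d f, ← integral_smul]
  refine integral_congr_ae (Eventually.of_forall fun s => ?_)
  simp only [Pi.smul_apply, mv_smul, smul_add]

/-- The trajectory of the auxiliary dynamics as a continuous linear function of the input. -/
noncomputable def auxC : L2 d.T n →L[ℝ] C(Time d.T, E n) :=
  LinearMap.mkContinuousOfExistsBound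
    { toFun := fun g => ⟨auxState d g, continuous_auxState d g⟩
      map_add' := fun f g => ContinuousMap.ext fun t => congrFun (auxState_add d f g) t
      map_smul' := fun c f => ContinuousMap.ext fun t => congrFun (auxState_smul d c f) t } (by
    obtain ⟨C, hC⟩ := exists_ode_bound d.T (mvL (d.A + d.G))
    refine ⟨Real.sqrt (C : ℝ), fun g => ?_⟩
    refine (ContinuousMap.norm_le _ (by positivity)).2 fun t => ?_
    have h := hC 0 g (Lp.aestronglyMeasurable g) t
    rw [← enorm_sq_L2] at h
    have h2 : ‖ode (mvL (d.A + d.G)) 0 g t‖₊ ^ 2 ≤ C * ‖g‖₊ ^ 2 := by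
      simp only [enorm_eq_nnnorm, nnnorm_zero, ENNReal.coe_zero, ne_eq, OfNat.ofNat_ne_zero,
        not_false_eq_true, zero_pow, zero_add] at h
      exact_mod_cast h
    have h3 : ‖ode (mvL (d.A + d.G)) 0 g t‖ ^ 2 ≤ C * ‖g‖ ^ 2 := h2
    refine abs_le_of_sq_le_sq' ?_ (by positivity) |>.2
    rw [mul_pow, Real.sq_sqrt (NNReal.coe_nonneg C)]
    exact h3)

/-- The input-to-trajectory operator on `L²`. -/
noncomputable def auxL : L2 d.T n →L[ℝ] L2 d.T n :=
  (ContinuousMap.toLp 2 (leb d.T) ℝ).comp (auxC d)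

theorem auxL_coeFn (g : L2 d.T n) : auxL d g =ᵐ[leb d.T] auxState d g :=
  ContinuousMap.coeFn_toLp (leb d.T) (auxC d g)

/-- The input-to-terminal-state operator. -/
noncomputable def auxT : L2 d.T n →L[ℝ] E n :=
  (ContinuousMap.evalCLM ℝ d.last).comp (auxC d)

theorem auxT_apply (g : L2 d.T n) : auxT d g = auxState d g d.last := rfl

/-- The symmetric matrix `(I - Γ)ᵀ Q (I - Γ)`. -/
noncomputable def Params.Qhat : Matrix (Fin n) (Fin n) ℝ :=
  (1 - d.Γ).transpose * d.Q * (1 - d.Γ)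

theorem Params.Qhat_psd : d.Qhat.PosSemidef := by
  have := d.Q_psd.conjTranspose_mul_mul_same (1 - d.Γ)
  simpa [Params.Qhat] using this

/-- The operator representing the quadratic form `J''`. -/
noncomputable def hess : L2 d.T n →L[ℝ] L2 d.T n :=
  (1 / d.γ) • ContinuousLinearMap.id ℝ _ -
    (auxL d).adjoint.comp (((mvL d.Qhat).compLpL 2 (leb d.T)).comp (auxL d)) -
    (auxT d).adjoint.comp ((mvL d.H).comp (auxT d))

theorem inner_hess (f g : L2 d.T n) :
    inner ℝ (hess d f) g = 1 / d.γ * inner ℝ f g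
      - ∫ t, inner ℝ (mv d.Qhat (auxState d f t)) (auxState d g t) ∂(leb d.T)
      - inner ℝ (mv d.H (auxState d f d.last)) (auxState d g d.last) := by
  simp only [hess, sub_apply, inner_sub_left, smul_apply,
    ContinuousLinearMap.comp_apply, ContinuousLinearMap.adjoint_inner_left, inner_smul_left,
    ContinuousLinearMap.id_apply, conj_trivial, auxT_apply, mvL_apply]
  congr 2
  rw [L2.inner_def]
  refine integral_congr_ae ?_
  filter_upwards [auxL_coeFn d f, auxL_coeFn d g,
    (mvL d.Qhat).coeFn_compLp (auxL d f)] with t h1 h2 h3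
  have h4 : ((mvL d.Qhat).compLpL 2 (leb d.T) (auxL d f)) t = mvL d.Qhat (auxL d f t) := h3
  rw [h4, h1, h2, mvL_apply]

theorem hess_symm (f g : L2 d.T n) : inner ℝ (hess d f) g = inner ℝ (hess d g) f := by
  rw [inner_hess, inner_hess, real_inner_comm]
  congr 1
  · congr 1
    refine integral_congr_ae (Eventually.of_forall fun t => ?_)
    simp only
    rw [inner_mv_comm d.Qhat_psd, real_inner_comm]
  · rw [inner_mv_comm d.H_psd, real_inner_comm]

theorem inner_L2_self {T : ℝ} {k : ℕ} (g : L2 T k) : ∫ t, ‖g t‖ ^ 2 ∂(leb T) = inner ℝ g g := by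
  rw [L2.inner_def]
  refine integral_congr_ae (Eventually.of_forall fun t => ?_)
  simp

theorem integrable_norm_sq_L2 {T : ℝ} {k : ℕ} (g : L2 T k) :
    Integrable (fun t => ‖g t‖ ^ 2) (leb T) :=
  (memLp_two_iff_integrable_sq_norm (Lp.aestronglyMeasurable g)).1 (Lp.memLp g)

theorem continuous_qf {k : ℕ} (M : Matrix (Fin k) (Fin k) ℝ) : Continuous (qf M) :=
  Continuous.inner continuous_id (continuous_mv M)

/-- This identity is what makes (H1) a coercivity statement about `hess d`. -/
theorem inner_hess_self (g : L2 d.T n) : inner ℝ (hess d g) g = J'' d g (auxState d g) := by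
  have i1 : Integrable (fun t => qf d.Qhat (auxState d g t)) (leb d.T) :=
    integrable_leb_of_continuous ((continuous_qf _).comp (continuous_auxState d g))
  have e1 := integral_sub ((integrable_norm_sq_L2 g).const_mul (1 / d.γ)) i1
  have e2 : ∀ t, 1 / d.γ * ‖g t‖ ^ 2 - qf d.Qhat (auxState d g t) =
      -qf ((1 - d.Γ).transpose * d.Q * (1 - d.Γ)) (auxState d g t) + 1 / d.γ * ‖g t‖ ^ 2 :=
    fun t => by rw [Params.Qhat]; ring
  simp_rw [e2] at e1
  rw [inner_hess, J'', e1, integral_const_mul, inner_L2_self]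
  simp only [qf, real_inner_comm]

theorem hess_coercive {ε : ℝ} (h : H1 d ε) (g : L2 d.T n) :
    ε * ‖g‖ ^ 2 ≤ inner ℝ (hess d g) g := by
  have := h.2 g _ (isAuxState_auxState d g)
  rw [inner_hess_self]
  linarith

end Aux

/-! ### Measurability and square integrability of processes. -/

section Processes

variable {Ω : Type*} [mΩ : MeasurableSpace Ω] {T : ℝ} {k l : ℕ}

/-- Progressive measurability at the terminal time `e` is joint measurability on the whole product.
-/
theorem progressive_joint {𝓕 : Filtration (Time T) mΩ} {x : Time T → Ω → E k} {e : Time T}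
    (he : ∀ t, t ≤ e) (hx : IsStronglyProgressive 𝓕 x) :
    StronglyMeasurable (fun z : Ω × Time T => x z.2 z.1) := by
  have hg : Measurable[_, Subtype.instMeasurableSpace.prod (𝓕 e)]
      (fun z : Ω × Time T => ((⟨z.2, he z.2⟩ : Iic e), z.1)) :=
    @Measurable.prodMk _ _ _ _ Subtype.instMeasurableSpace (𝓕 e) _ _
      (measurable_snd.subtype_mk) (measurable_fst.mono le_rfl (𝓕.le e))
  exact (hx e).comp_measurable hg

theorem lintegral_prod_sq (P : Measure Ω) {x : Time T → Ω → E k}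
    (hx : StronglyMeasurable (fun z : Ω × Time T => x z.2 z.1)) :
    eLpNorm (fun z : Ω × Time T => x z.2 z.1) 2 (P.prod (leb T)) ^ 2 =
      ∫⁻ ω, (∫⁻ t, ‖x t ω‖ₑ ^ 2 ∂(leb T)) ∂P := by
  have := eLpNorm_nnreal_pow_eq_lintegral (μ := P.prod (leb T))
    (f := fun z : Ω × Time T => x z.2 z.1) (p := 2) (by norm_num)
  rw [← lintegral_prod (fun z : Ω × Time T => ‖x z.2 z.1‖ₑ ^ 2)
    (hx.enorm.pow_const 2).aemeasurable]
  simpa using this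

theorem IsL2Process.memLp {𝓕 : Filtration (Time T) mΩ} {P : Measure Ω} {x : Time T → Ω → E k}
    {e : Time T} (he : ∀ t, t ≤ e) (hx : IsL2Process 𝓕 P x) :
    MemLp (fun z : Ω × Time T => x z.2 z.1) 2 (P.prod (leb T)) := by
  have hm := progressive_joint he hx.progressive
  refine ⟨hm.aestronglyMeasurable, ?_⟩
  have h := hx.finite
  rw [← lintegral_prod_sq P hm] at h
  exact (ENNReal.pow_lt_top_iff.1 h).resolve_right (by norm_num)

theorem isL2Process_of_memLp {𝓕 : Filtration (Time T) mΩ} {P : Measure Ω}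
    {x : Time T → Ω → E k} {e : Time T} (he : ∀ t, t ≤ e) (hp : IsStronglyProgressive 𝓕 x)
    (hx : MemLp (fun z : Ω × Time T => x z.2 z.1) 2 (P.prod (leb T))) : IsL2Process 𝓕 P x := by
  refine ⟨hp, ?_⟩
  rw [← lintegral_prod_sq P (progressive_joint he hp)]
  exact ENNReal.pow_lt_top hx.2

/-- A square integrable process has almost surely square integrable paths. -/
theorem ae_memLp_path {P : Measure Ω} [SFinite P] {x : Time T → Ω → E k}
    (hm : StronglyMeasurable (fun z : Ω × Time T => x z.2 z.1))
    (hx : MemLp (fun z : Ω × Time T => x z.2 z.1) 2 (P.prod (leb T))) :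
    ∀ᵐ ω ∂P, MemLp (fun t => x t ω) 2 (leb T) := by
  have h : ∫⁻ ω, (∫⁻ t, ‖x t ω‖ₑ ^ 2 ∂(leb T)) ∂P < ∞ := by
    rw [← lintegral_prod_sq P hm]
    exact ENNReal.pow_lt_top hx.2
  have h2 := ae_lt_top' (Measurable.lintegral_prod_right'
    (hm.enorm.pow_const 2)).aemeasurable h.ne
  filter_upwards [h2] with ω hω
  refine ⟨(hm.comp_measurable (measurable_prodMk_left (x := ω))).aestronglyMeasurable, ?_⟩
  have := eLpNorm_nnreal_pow_eq_lintegral (μ := leb T)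
    (f := fun t : Time T => x t ω) (p := 2) (by norm_num)
  have h3 : eLpNorm (fun t : Time T => x t ω) 2 (leb T) ^ 2 < ∞ := by
    refine lt_of_eq_of_lt ?_ hω
    simpa using this
  exact (ENNReal.pow_lt_top_iff.1 h3).resolve_right (by norm_num)

/-- Integrals of square integrable processes up to a fixed time are square integrable. -/
theorem memLp_setIntegral {P : Measure Ω} [SFinite P] {x : Time T → Ω → E k}
    (hm : StronglyMeasurable (fun z : Ω × Time T => x z.2 z.1))
    (hx : MemLp (fun z : Ω × Time T => x z.2 z.1) 2 (P.prod (leb T))) (t : Time T) :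
    MemLp (fun ω => ∫ s in Iic t, x s ω ∂(leb T)) 2 P := by
  have hm2 : StronglyMeasurable (fun ω => ∫ s in Iic t, x s ω ∂(leb T)) :=
    hm.integral_prod_right'
  refine ⟨hm2.aestronglyMeasurable, ?_⟩
  rw [eLpNorm_lt_top_iff_lintegral_rpow_enorm_lt_top (by norm_num) (by norm_num)]
  have h : ∫⁻ ω, (∫⁻ t, ‖x t ω‖ₑ ^ 2 ∂(leb T)) ∂P < ∞ := by
    rw [← lintegral_prod_sq P hm]
    exact ENNReal.pow_lt_top hx.2
  refine lt_of_le_of_lt (b := ∫⁻ ω, leb T univ * (∫⁻ t, ‖x t ω‖ₑ ^ 2 ∂(leb T)) ∂P) ?_ ?_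
  · refine lintegral_mono fun ω => ?_
    have := enorm_sq_setIntegral_le (k := fun s => x s ω)
      (hm.comp_measurable (measurable_prodMk_left (x := ω))).aestronglyMeasurable t
    simpa using this
  · rw [lintegral_const_mul' _ _ (measure_ne_top _ _)]
    exact ENNReal.mul_lt_top (measure_lt_top _ _) h

/-- Only the restriction of `q` to times up to `t` is constrained, so the lemma can be applied with
the σ-algebra `𝓕 t` on `Ω`; this gives adaptedness of pathwise solutions. -/
theorem stronglyMeasurable_setIntegral {t : Time T} {q : Time T → Ω → E k}
    (hq : StronglyMeasurable fun p : Iic t × Ω => q p.1 p.2) :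
    StronglyMeasurable fun ω => ∫ s in Iic t, q s ω ∂(leb T) := by
  have (ω : Ω) := integral_subtype_comap (μ := leb T) (measurableSet_Iic (a := t)) fun s => q s ω
  simp_rw [← this]
  have : IsFiniteMeasure (Measure.comap (Subtype.val : Iic t → Time T) (leb T)) := by
    refine ⟨?_⟩
    rw [(MeasurableEmbedding.subtype_coe measurableSet_Iic).comap_apply]
    exact measure_lt_top _ _
  exact hq.integral_prod_left'

theorem progressive_deterministic (𝓕 : Filtration (Time T) mΩ) {φ : Time T → E k}
    (hφ : StronglyMeasurable φ) : IsStronglyProgressive 𝓕 fun t _ => φ t := fun t => by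
  have hg : Measurable[Subtype.instMeasurableSpace.prod (𝓕 t), _]
      (fun z : Iic t × Ω => (z.1 : Time T)) :=
    measurable_subtype_coe.comp (@measurable_fst _ _ _ (𝓕 t))
  exact hφ.comp_measurable hg

theorem progressive_mv {𝓕 : Filtration (Time T) mΩ} {x : Time T → Ω → E l}
    (hx : IsStronglyProgressive 𝓕 x) (M : Matrix (Fin k) (Fin l) ℝ) :
    IsStronglyProgressive 𝓕 fun t ω => mv M (x t ω) := fun t =>
  (continuous_mv M).comp_stronglyMeasurable (hx t)

theorem memLp_mv {α : Type*} [MeasurableSpace α] {μ : Measure α} {x : α → E l} (hx : MemLp x 2 μ)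
    (M : Matrix (Fin k) (Fin l) ℝ) : MemLp (fun a => mv M (x a)) 2 μ :=
  (mvL M).comp_memLp' hx

theorem progressive_indicator {𝓕 : Filtration (Time T) mΩ} {x : Time T → Ω → E k}
    (hx : IsStronglyProgressive 𝓕 x) {s : Set Ω} (hs : ∀ t, MeasurableSet[𝓕 t] s) :
    IsStronglyProgressive 𝓕 fun t => s.indicator (x t) := fun t => by
  have h1 : MeasurableSet[Subtype.instMeasurableSpace.prod (𝓕 t)]
      {z : Iic t × Ω | z.2 ∈ s} := (@measurable_snd _ _ _ (𝓕 t)) (hs t)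
  exact (hx t).indicator h1

theorem progressive_ode {𝓕 : Filtration (Time T) mΩ} {q : Time T → Ω → E k}
    (hq : IsStronglyProgressive 𝓕 q) (L : E k →L[ℝ] E k) (y₀ : E k)
    (hi : ∀ ω, Integrable (fun s => q s ω) (leb T)) :
    IsStronglyProgressive 𝓕 fun t ω => ode L y₀ (fun s => q s ω) t := by
  refine StronglyAdapted.isStronglyProgressive_of_continuous (fun t => ?_)
    fun ω => continuous_ode L y₀ (hi ω)
  refine (flow L t).continuous.comp_stronglyMeasurable (stronglyMeasurable_const.add ?_)
  refine @stronglyMeasurable_setIntegral Ω (𝓕 t) T k t (fun s ω => flow (-L) s (q s ω)) ?_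
  have hg : Measurable[Subtype.instMeasurableSpace.prod (𝓕 t), _]
      (fun z : Iic t × Ω => (z.1 : Time T)) :=
    measurable_subtype_coe.comp (@measurable_fst _ _ _ (𝓕 t))
  have h1 := (continuous_flow (T := T) (-L)).stronglyMeasurable.comp_measurable hg
  have h2 : Continuous fun p : (E k →L[ℝ] E k) × E k => p.1 p.2 := by fun_prop
  exact h2.comp_stronglyMeasurable (h1.prodMk (hq t))

theorem memLp_ode {P : Measure Ω} [IsFiniteMeasure P] {q : Time T → Ω → E k} (L : E k →L[ℝ] E k)
    (y₀ : E k) (hm : StronglyMeasurable (fun z : Ω × Time T => q z.2 z.1))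
    (hq : MemLp (fun z : Ω × Time T => q z.2 z.1) 2 (P.prod (leb T)))
    (hy : StronglyMeasurable (fun z : Ω × Time T => ode L y₀ (fun s => q s z.1) z.2)) :
    MemLp (fun z : Ω × Time T => ode L y₀ (fun s => q s z.1) z.2) 2 (P.prod (leb T)) := by
  obtain ⟨C, hC⟩ := exists_ode_bound T L
  refine ⟨hy.aestronglyMeasurable, ?_⟩
  have h : ∫⁻ ω, (∫⁻ t, ‖q t ω‖ₑ ^ 2 ∂(leb T)) ∂P < ∞ := by
    rw [← lintegral_prod_sq P hm]
    exact ENNReal.pow_lt_top hq.2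
  have h2 : ∫⁻ ω, (∫⁻ t, ‖ode L y₀ (fun s => q s ω) t‖ₑ ^ 2 ∂(leb T)) ∂P < ∞ := by
    refine lt_of_le_of_lt (b := ∫⁻ ω, (∫⁻ _ : Time T, C * (‖y₀‖ₑ ^ 2 +
      ∫⁻ s, ‖q s ω‖ₑ ^ 2 ∂(leb T)) ∂(leb T)) ∂P) ?_ ?_
    · refine lintegral_mono fun ω => lintegral_mono fun t => ?_
      exact hC y₀ _ (hm.comp_measurable (measurable_prodMk_left (x := ω))).aestronglyMeasurable t
    · simp_rw [lintegral_const]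
      rw [lintegral_mul_const' _ _ (measure_ne_top _ _), lintegral_const_mul' _ _ (by simp),
        lintegral_add_left measurable_const, lintegral_const]
      refine ENNReal.mul_lt_top (ENNReal.mul_lt_top (by simp) (ENNReal.add_lt_top.2 ⟨?_, h⟩))
        (measure_lt_top _ _)
      exact ENNReal.mul_lt_top (by simp) (measure_lt_top _ _)
  rw [← lintegral_prod_sq P (x := fun t ω => ode L y₀ (fun s => q s ω) t) hy] at h2
  exact (ENNReal.pow_lt_top_iff.1 h2).resolve_right (by norm_num)

end Processes

/-! ### Second moments and progressive versions of Brownian motion. -/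

section Brownian

variable {Ω : Type*} [mΩ : MeasurableSpace Ω] {T : ℝ} {k N : ℕ}

theorem lintegral_gaussian_sq {t : ℝ} (ht : 0 ≤ t) :
    ∫⁻ v : E k, ‖v‖ₑ ^ 2 ∂(multivariateGaussian 0 (t • (1 : Matrix (Fin k) (Fin k) ℝ))) =
      k * ENNReal.ofReal t := by
  have hS : (t • (1 : Matrix (Fin k) (Fin k) ℝ)).PosSemidef := Matrix.PosSemidef.one.smul ht
  have h1 (v : E k) : ‖v‖ₑ ^ 2 = ∑ i, ENNReal.ofReal (v i ^ 2) := by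
    rw [← ofReal_norm, ← ENNReal.ofReal_pow (norm_nonneg _), EuclideanSpace.norm_sq_eq,
      ENNReal.ofReal_sum_of_nonneg (fun i _ => by positivity)]
    simp
  simp_rw [h1]
  rw [lintegral_finsetSum _ (fun i _ => by fun_prop)]
  have h2 (i : Fin k) : ∫⁻ v : E k, ENNReal.ofReal (v i ^ 2)
      ∂(multivariateGaussian 0 (t • (1 : Matrix (Fin k) (Fin k) ℝ))) = ENNReal.ofReal t := by
    have hmp := measurePreserving_eval_multivariateGaussian (μ := (0 : E k)) hS (i := i)
    have h3 := hmp.lintegral_comp (f := fun x : ℝ => ENNReal.ofReal (x ^ 2)) (by fun_prop)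
    have h4 : (((t • (1 : Matrix (Fin k) (Fin k) ℝ)) i i).toNNReal : ℝ) = t := by
      simp [ht]
    rw [h3, ← h4, ← variance_id_gaussianReal (μ := 0),
      ofReal_variance (memLp_id_gaussianReal 2), evariance_eq_lintegral_ofReal]
    simp [integral_id_gaussianReal, max_eq_left ht]
  simp [h2]

theorem IsStandardBrownian.lintegral_sq_le {W : Time T → Ω → E k} {P : Measure Ω}
    (hW : IsStandardBrownian W P) (t : Time T) :
    ∫⁻ ω, ‖W t ω‖ₑ ^ 2 ∂P ≤ k * ENNReal.ofReal T := by
  have h0 : (0 : ℝ) ∈ Icc 0 T := ⟨le_rfl, t.2.1.trans t.2.2⟩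
  have hl := hW.law ⟨0, h0⟩ t t.2.1
  have h1 := hl.lintegral_comp (f := fun v : E k => ‖v‖ₑ ^ 2) (by fun_prop)
  have h2 : ∫⁻ ω, ‖W t ω‖ₑ ^ 2 ∂P = ∫⁻ ω, ‖W t ω - W ⟨0, h0⟩ ω‖ₑ ^ 2 ∂P := by
    refine lintegral_congr_ae ?_
    filter_upwards [hW.zero ⟨0, h0⟩ rfl] with ω hω
    rw [hω, sub_zero]
  rw [h2, h1, lintegral_gaussian_sq (by simpa using t.2.1)]
  gcongr
  simpa using t.2.2

theorem IsStandardBrownian.memLp {W : Time T → Ω → E k} {P : Measure Ω}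
    (hW : IsStandardBrownian W P) (t : Time T) : MemLp (W t) 2 P := by
  refine ⟨(hW.measurable t).aestronglyMeasurable, ?_⟩
  rw [eLpNorm_lt_top_iff_lintegral_rpow_enorm_lt_top (by norm_num) (by norm_num)]
  refine lt_of_le_of_lt ?_ (ENNReal.mul_lt_top (ENNReal.natCast_lt_top k)
    (ENNReal.ofReal_lt_top (r := T)))
  simpa using hW.lintegral_sq_le t

/-- Completing the filtration is what allows processes to be altered on a null set without losing
adaptedness. -/
theorem measurableSet_brownianFiltration_of_null {P : Measure Ω} [P.IsComplete]
    {W : Fin N → Time T → Ω → E k} (hW : ∀ j t, Measurable (W j t)) {a : Set Ω} (ha : P a = 0)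
    (t : Time T) : MeasurableSet[brownianFiltration W P hW t] a :=
  (le_sup_right (a := ⨆ (j : Fin N) (s : Time T) (_ : s ≤ t),
    MeasurableSpace.comap (W j s) inferInstance)) a (MeasurableSpace.measurableSet_generateFrom ha)

theorem adapted_brownianFiltration {P : Measure Ω} [P.IsComplete]
    {W : Fin N → Time T → Ω → E k} (hW : ∀ j t, Measurable (W j t)) (i : Fin N) (t : Time T) :
    StronglyMeasurable[brownianFiltration W P hW t] (W i t) := by
  refine Measurable.stronglyMeasurable ?_
  refine Measurable.mono (comap_measurable (W i t)) ?_ le_rfl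
  exact le_sup_of_le_left (le_iSup_of_le i (le_iSup_of_le t (le_iSup_of_le le_rfl le_rfl)))

/-- A Brownian motion with almost surely continuous paths, modified to be zero on a null set. -/
theorem isL2Process_indicator_brownian {P : Measure Ω} [P.IsComplete]
    [IsFiniteMeasure P] {W : Fin N → Time T → Ω → E k}
    (hW : ∀ j, IsStandardBrownian (W j) P) (i : Fin N) {e : Time T} (he : ∀ t, t ≤ e)
    {s : Set Ω} (hs : P sᶜ = 0) (hc : ∀ ω ∈ s, Continuous fun t => W i t ω) :
    IsL2Process (brownianFiltration W P fun j => (hW j).measurable) P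
      (fun t => s.indicator (W i t)) ∧ ∀ ω, Continuous fun t => s.indicator (W i t) ω := by
  set 𝓕 := brownianFiltration W P fun j => (hW j).measurable
  have hms (t : Time T) : MeasurableSet[𝓕 t] s := by
    have h : MeasurableSet[𝓕 t] sᶜ := measurableSet_brownianFiltration_of_null _ hs t
    simpa using h.compl
  have hcont : ∀ ω, Continuous fun t => s.indicator (W i t) ω := fun ω => by
    by_cases hω : ω ∈ s
    · simpa [hω] using hc ω hω
    · simpa [hω] using continuous_const
  have hp : IsStronglyProgressive 𝓕 (fun t => s.indicator (W i t)) :=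
    StronglyAdapted.isStronglyProgressive_of_continuous
      (fun t => (adapted_brownianFiltration _ i t).indicator (hms t)) hcont
  refine ⟨⟨hp, ?_⟩, hcont⟩
  have hm := progressive_joint he hp
  -- With the time integral outside, the second moment bound, uniform in `t`, applies at each fixed
  -- time.
  rw [lintegral_lintegral_swap (f := fun ω t => ‖s.indicator (W i t) ω‖ₑ ^ 2)
    (hm.enorm.pow_const 2).aemeasurable]
  refine lt_of_le_of_lt (b := ∫⁻ _ : Time T, k * ENNReal.ofReal T ∂(leb T)) ?_ ?_
  · refine lintegral_mono fun t => le_trans (lintegral_mono fun ω => ?_)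
      ((hW i).lintegral_sq_le t)
    gcongr
    exact enorm_indicator_le_enorm_self _ _
  · rw [lintegral_const]
    exact ENNReal.mul_lt_top (ENNReal.mul_lt_top (ENNReal.natCast_lt_top k)
      ENNReal.ofReal_lt_top) (measure_lt_top _ _)

end Brownian

/-! ### Well-posedness of the state equations and dependence on the disturbance. -/

section States

variable {Ω : Type*} [mΩ : MeasurableSpace Ω] {n n₁ n₂ N : ℕ} {d : Params n n₁ n₂}
  {𝓕 : Filtration (Time d.T) mΩ} {P : Measure Ω}

theorem integrable_mv {k l : ℕ} {α : Type*} [MeasurableSpace α] {μ : Measure α} {x : α → E l}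
    (hx : Integrable x μ) (M : Matrix (Fin k) (Fin l) ℝ) : Integrable (fun a => mv M (x a)) μ :=
  (mvL M).integrable_comp hx

theorem mv_add_matrix {k l : ℕ} (M M' : Matrix (Fin k) (Fin l) ℝ) (v : E l) :
    mv (M + M') v = mv M v + mv M' v := by
  simp only [mv, map_add, LinearMap.add_apply]

/-- Two state pairs driven by disturbances `f` and `f'` differ by the auxiliary state driven by
`f' - f`. -/
theorem IsState.diff [IsProbabilityMeasure P] {W : Time d.T → Ω → E n₂} {x₀ : E n}
    {ubar : Time d.T → E n₁} (hubar : Continuous ubar) {u : Time d.T → Ω → E n₁}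
    (hu : IsL2Process 𝓕 P u) {f f' : Time d.T → E n} (hf : Integrable f (leb d.T))
    (hf' : Integrable f' (leb d.T)) {x x' : Time d.T → Ω → E n} {m m' : Time d.T → E n}
    (h : IsState d 𝓕 P W x₀ ubar u f x m) (h' : IsState d 𝓕 P W x₀ ubar u f' x' m')
    {g : L2 d.T n} (hg : (fun t => f' t - f t) =ᵐ[leb d.T] g) :
    (∀ᵐ ω ∂P, ∀ t, x' t ω = x t ω + auxState d g t) ∧ m' = m + auxState d g := by
  have im := integrable_of_memLp_two h.m_mem
  have im' := integrable_of_memLp_two h'.m_mem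
  have iub := integrable_leb_of_continuous hubar
  have hz : ∀ t, m' t - m t =
      ∫ s in Iic t, (mv (d.A + d.G) (m' s - m s) + (f' s - f s)) ∂(leb d.T) := fun t => by
    rw [h'.m_eq, h.m_eq, add_sub_add_left_eq_sub, ← integral_sub]
    · refine integral_congr_ae (Eventually.of_forall fun s => ?_)
      simp only [mv_sub]
      abel
    · exact (((integrable_mv im' _).add (integrable_mv iub _)).add hf').restrict
    · exact (((integrable_mv im _).add (integrable_mv iub _)).add hf).restrict
  have hm : (fun t => m' t - m t) = auxState d g := eq_auxState d (im'.sub im) hg hz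
  have hmt (t : Time d.T) : m' t - m t = auxState d g t := congrFun hm t
  refine ⟨?_, funext fun t => by rw [Pi.add_apply, ← hmt]; abel⟩
  filter_upwards [h.x_eq, h'.x_eq,
    ae_memLp_path (progressive_joint d.le_last h.x_mem.progressive) (h.x_mem.memLp d.le_last),
    ae_memLp_path (progressive_joint d.le_last h'.x_mem.progressive) (h'.x_mem.memLp d.le_last),
    ae_memLp_path (progressive_joint d.le_last hu.progressive) (hu.memLp d.le_last)]
    with ω hx hx' px px' pu t
  have ix := integrable_of_memLp_two px
  have ix' := integrable_of_memLp_two px'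
  have iu := integrable_of_memLp_two pu
  have i1 := ((((integrable_mv ix' d.A).add (integrable_mv iu d.B)).add
    (integrable_mv im' d.G)).add hf')
  have i2 := ((((integrable_mv ix d.A).add (integrable_mv iu d.B)).add
    (integrable_mv im d.G)).add hf)
  have i3 := (integrable_mv (im'.sub im) (d.A + d.G)).add (hf'.sub hf)
  -- The drift of the difference is `A (x' - x) + G (m' - m) - (A + G) (m' - m)`, that is `A` times
  -- the difference itself; uniqueness makes it vanish.
  have key : (fun t => x' t ω - x t ω - (m' t - m t)) = ode (mvL d.A) 0 (fun _ => 0) := by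
    refine eq_ode _ _ (integrable_zero _ _ _) ((ix'.sub ix).sub (im'.sub im)) fun t => ?_
    rw [hx' t, hx t, hz t, add_sub_add_right_eq_sub, add_sub_add_left_eq_sub, zero_add]
    have e1 := integral_sub (i1.restrict (s := Iic t)) (i2.restrict (s := Iic t))
    have e2 := integral_sub ((i1.sub i2).restrict (s := Iic t)) (i3.restrict (s := Iic t))
    simp only [Pi.add_apply, Pi.sub_apply] at e1 e2
    rw [← e1, ← e2]
    refine integral_congr_ae (Eventually.of_forall fun s => ?_)
    simp only [mvL_apply, mv_sub, mv_add_matrix]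
    abel
  have h0 := congrFun key t
  simp only [ode, map_zero, integral_zero, add_zero, hmt] at h0
  rw [sub_sub, sub_eq_zero] at h0
  exact h0

theorem IsState.congr {W : Time d.T → Ω → E n₂} {x₀ : E n}
    {ubar : Time d.T → E n₁} {u : Time d.T → Ω → E n₁} {f f' : Time d.T → E n}
    {x : Time d.T → Ω → E n} {m : Time d.T → E n}
    (h : IsState d 𝓕 P W x₀ ubar u f x m) (hf : f =ᵐ[leb d.T] f') :
    IsState d 𝓕 P W x₀ ubar u f' x m where
  x_mem := h.x_mem
  m_mem := h.m_mem
  x_eq := by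
    filter_upwards [h.x_eq] with ω hω t
    rw [hω t]
    congr 2
    refine integral_congr_ae (ae_restrict_of_ae ?_)
    filter_upwards [hf] with s hs
    rw [hs]
  m_eq t := by
    rw [h.m_eq t]
    congr 1
    refine integral_congr_ae (ae_restrict_of_ae ?_)
    filter_upwards [hf] with s hs
    rw [hs]

/-- Put `x = y + D W`, where `y` solves pathwise a linear equation with the extra forcing `A D W`.
-/
theorem exists_isState [IsProbabilityMeasure P] [P.IsComplete] {W : Fin N → Time d.T → Ω → E n₂}
    (hW : ∀ j, IsStandardBrownian (W j) P)
    (h𝓕 : 𝓕 = brownianFiltration W P (fun j => (hW j).measurable)) (i : Fin N) (x₀ : E n)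
    {ubar : Time d.T → E n₁} (hubar : Continuous ubar) {u : Time d.T → Ω → E n₁}
    (hu : IsL2Process 𝓕 P u) {f : Time d.T → E n} (hfm : StronglyMeasurable f)
    (hf : MemLp f 2 (leb d.T)) :
    ∃ x m, IsState d 𝓕 P (W i) x₀ ubar u f x m ∧ Continuous m := by
  have hfi := integrable_of_memLp_two hf
  have im : Integrable (fun s => mv d.B (ubar s) + f s) (leb d.T) :=
    (integrable_mv (integrable_leb_of_continuous hubar) _).add hfi
  obtain ⟨m, hm⟩ : ∃ m, m = ode (mvL (d.A + d.G)) d.m₀ (fun s => mv d.B (ubar s) + f s) := ⟨_, rfl⟩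
  have hmc : Continuous m := hm ▸ continuous_ode _ _ im
  -- Off this set of good paths `W` and `u` are set to zero, so that the forcing is integrable for
  -- every `ω`, as `progressive_ode` demands.
  obtain ⟨s, hs⟩ : ∃ s : Set Ω,
    s = {ω | (Continuous fun t => W i t ω) ∧ MemLp (fun t => u t ω) 2 (leb d.T)} := ⟨_, rfl⟩
  have hsae : ∀ᵐ ω ∂P, ω ∈ s := by
    rw [hs]
    filter_upwards [(hW i).continuous, ae_memLp_path
      (progressive_joint d.le_last hu.progressive) (hu.memLp d.le_last)] with ω h1 h2
    exact ⟨h1, h2⟩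
  have hs0 : P sᶜ = 0 := mem_ae_iff.1 hsae
  obtain ⟨hWL, hWc⟩ := isL2Process_indicator_brownian hW i d.le_last hs0
    (fun ω hω => by rw [hs] at hω; exact hω.1)
  rw [← h𝓕] at hWL
  have hms (t : Time d.T) : MeasurableSet[𝓕 t] s := by
    have h : MeasurableSet[𝓕 t] sᶜ := by
      rw [h𝓕]
      exact measurableSet_brownianFiltration_of_null _ hs0 t
    simpa using h.compl
  have hup : IsStronglyProgressive 𝓕 (fun t => s.indicator (u t)) :=
    progressive_indicator hu.progressive hms
  have hum : MemLp (fun z : Ω × Time d.T => s.indicator (u z.2) z.1) 2 (P.prod (leb d.T)) := by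
    refine (hu.memLp d.le_last).mono (progressive_joint d.le_last hup).aestronglyMeasurable
      (Eventually.of_forall fun z => ?_)
    exact norm_indicator_le_norm_self _ _
  have hui (ω : Ω) : Integrable (fun t => s.indicator (u t) ω) (leb d.T) := by
    by_cases hω : ω ∈ s
    · simp only [indicator_of_mem hω]
      rw [hs] at hω
      exact integrable_of_memLp_two hω.2
    · simp only [indicator_of_notMem hω]
      exact integrable_zero _ _ _
  set q : Time d.T → Ω → E n := fun t ω => mv d.A (mv d.D (s.indicator (W i t) ω)) +
    mv d.B (s.indicator (u t) ω) + mv d.G (m t) + f t with hq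
  have hqp : IsStronglyProgressive 𝓕 q :=
    (((progressive_mv (progressive_mv hWL.progressive _) _).add (progressive_mv hup _)).add
      (progressive_mv (progressive_deterministic 𝓕 hmc.stronglyMeasurable) _)).add
      (progressive_deterministic 𝓕 hfm)
  have hqm : MemLp (fun z : Ω × Time d.T => q z.2 z.1) 2 (P.prod (leb d.T)) :=
    (((memLp_mv (memLp_mv (hWL.memLp d.le_last) _) _).add (memLp_mv hum _)).add
      (memLp_mv ((memLp_of_continuous hmc).comp_snd P) _)).add (hf.comp_snd P)
  have hqi (ω : Ω) : Integrable (fun t => q t ω) (leb d.T) :=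
    (((integrable_mv (integrable_mv (integrable_leb_of_continuous (hWc ω)) _) _).add
      (integrable_mv (hui ω) _)).add
      (integrable_mv (integrable_leb_of_continuous hmc) _)).add hfi
  have hyp := progressive_ode hqp (mvL d.A) x₀ hqi
  have hym := memLp_ode (P := P) (mvL d.A) x₀ (progressive_joint d.le_last hqp) hqm
    (progressive_joint d.le_last hyp)
  have hxp := hyp.add (progressive_mv hWL.progressive d.D)
  refine ⟨fun t ω => ode (mvL d.A) x₀ (fun s => q s ω) t + mv d.D (s.indicator (W i t) ω), m,
    ⟨isL2Process_of_memLp d.le_last hxp (hym.add (memLp_mv (hWL.memLp d.le_last) _)),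
      memLp_of_continuous hmc, ?_, fun t => ?_⟩, hmc⟩
  · filter_upwards [hsae] with ω hω t
    rw [ode_eq _ _ (hqi ω)]
    simp only [hq, indicator_of_mem hω]
    congr 2
    refine integral_congr_ae (Eventually.of_forall fun r => ?_)
    simp only [mvL_apply, mv_add]
    abel
  · conv_lhs => rw [hm, ode_eq _ _ im, ← hm]
    congr 1
    refine integral_congr_ae (Eventually.of_forall fun r => ?_)
    simp only [mvL_apply]
    abel

theorem IsState.continuous_m {W : Time d.T → Ω → E n₂} {x₀ : E n}
    {ubar : Time d.T → E n₁} (hubar : Continuous ubar) {u : Time d.T → Ω → E n₁}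
    {f : Time d.T → E n} (hf : Integrable f (leb d.T))
    {x : Time d.T → Ω → E n} {m : Time d.T → E n}
    (h : IsState d 𝓕 P W x₀ ubar u f x m) : Continuous m := by
  rw [funext h.m_eq]
  exact continuous_const.add (continuous_primitive_leb
    (((integrable_mv (integrable_of_memLp_two h.m_mem) _).add
      (integrable_mv (integrable_leb_of_continuous hubar) _)).add hf))

/-- Membership in `L²` of the product controls only almost every time; the equation itself gives
square integrability at each time, in particular at `T`. -/
theorem IsState.memLp_apply [IsProbabilityMeasure P] {W : Time d.T → Ω → E n₂}
    (hW : IsStandardBrownian W P) {x₀ : E n}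
    {ubar : Time d.T → E n₁} (hubar : Continuous ubar) {u : Time d.T → Ω → E n₁}
    (hu : IsL2Process 𝓕 P u) {f : Time d.T → E n} (hfm : StronglyMeasurable f)
    (hf : MemLp f 2 (leb d.T)) {x : Time d.T → Ω → E n} {m : Time d.T → E n}
    (h : IsState d 𝓕 P W x₀ ubar u f x m) (t : Time d.T) : MemLp (x t) 2 P := by
  have hmc := h.continuous_m hubar (integrable_of_memLp_two hf)
  have hrp : IsStronglyProgressive 𝓕
      (fun s ω => mv d.A (x s ω) + mv d.B (u s ω) + mv d.G (m s) + f s) :=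
    (((progressive_mv h.x_mem.progressive _).add (progressive_mv hu.progressive _)).add
      (progressive_mv (progressive_deterministic 𝓕 hmc.stronglyMeasurable) _)).add
      (progressive_deterministic 𝓕 hfm)
  have hrm : MemLp (fun z : Ω × Time d.T =>
      mv d.A (x z.2 z.1) + mv d.B (u z.2 z.1) + mv d.G (m z.2) + f z.2) 2 (P.prod (leb d.T)) :=
    (((memLp_mv (h.x_mem.memLp d.le_last) _).add (memLp_mv (hu.memLp d.le_last) _)).add
      (memLp_mv (h.m_mem.comp_snd P) _)).add (hf.comp_snd P)
  have h1 := memLp_setIntegral (progressive_joint d.le_last hrp) hrm t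
  refine (((memLp_const x₀).add h1).add (memLp_mv (hW.memLp t) d.D)).ae_eq ?_
  filter_upwards [h.x_eq] with ω hω
  exact (hω t).symm

theorem memLp_mean [IsProbabilityMeasure P] {T : ℝ} {k : ℕ} {x : Time T → Ω → E k}
    (hm : StronglyMeasurable (fun z : Ω × Time T => x z.2 z.1))
    (hx : MemLp (fun z : Ω × Time T => x z.2 z.1) 2 (P.prod (leb T))) :
    MemLp (fun t => ∫ ω, x t ω ∂P) 2 (leb T) := by
  refine ⟨(hm.integral_prod_left' (μ := P)).aestronglyMeasurable, ?_⟩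
  rw [eLpNorm_lt_top_iff_lintegral_rpow_enorm_lt_top (by norm_num) (by norm_num)]
  have h : ∫⁻ ω, (∫⁻ t, ‖x t ω‖ₑ ^ 2 ∂(leb T)) ∂P < ∞ := by
    rw [← lintegral_prod_sq P hm]
    exact ENNReal.pow_lt_top hx.2
  rw [lintegral_lintegral_swap (f := fun ω t => ‖x t ω‖ₑ ^ 2)
    (hm.enorm.pow_const 2).aemeasurable] at h
  refine lt_of_le_of_lt (lintegral_mono fun t => ?_) h
  have hmt := hm.comp_measurable (measurable_prodMk_right (y := t))
  have h1 := sq_lintegral_le P hmt.enorm.aemeasurable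
  have h2 : ‖∫ ω, x t ω ∂P‖ₑ ^ 2 ≤ (∫⁻ ω, ‖x t ω‖ₑ ∂P) ^ 2 := by
    gcongr
    exact enorm_integral_le_lintegral_enorm _
  simpa using h2.trans (by simpa using h1)

theorem IsSolution.isState {W : Time d.T → Ω → E n₂} {x₀ : E n}
    {ubar : Time d.T → E n₁} {u : Time d.T → Ω → E n₁}
    {x : Time d.T → Ω → E n} {m p : Time d.T → E n}
    (h : IsSolution d 𝓕 P W x₀ ubar u x m p) :
    IsState d 𝓕 P W x₀ ubar u (fun t => d.γ • p t) x m :=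
  ⟨h.x_mem, h.m_mem, h.x_eq, h.m_eq⟩

/-- The source term of the adjoint equation. -/
noncomputable def source (d : Params n n₁ n₂) (P : Measure Ω) (x : Time d.T → Ω → E n)
    (m : Time d.T → E n) (s : Time d.T) : E n :=
  mv ((1 - d.Γ).transpose * d.Q) ((∫ ω, x s ω ∂P) - (mv d.Γ (m s) + d.η))

theorem integrable_source [IsProbabilityMeasure P] {x : Time d.T → Ω → E n}
    {m : Time d.T → E n} (hx : IsL2Process 𝓕 P x) (hm : MemLp m 2 (leb d.T)) :
    Integrable (source d P x m) (leb d.T) :=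
  integrable_mv ((integrable_of_memLp_two (memLp_mean (progressive_joint d.le_last hx.progressive)
    (hx.memLp d.le_last))).sub
      ((integrable_mv (integrable_of_memLp_two hm) _).add (integrable_const _))) _

theorem IsSolution.continuous_p [IsProbabilityMeasure P] {W : Time d.T → Ω → E n₂} {x₀ : E n}
    {ubar : Time d.T → E n₁} {u : Time d.T → Ω → E n₁}
    {x : Time d.T → Ω → E n} {m p : Time d.T → E n}
    (h : IsSolution d 𝓕 P W x₀ ubar u x m p) : Continuous p := by
  have i1 := integrable_source h.x_mem h.m_mem
  have i2 := integrable_of_memLp_two h.p_mem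
  rw [funext (dual_forward i2 i1 h.p_eq)]
  exact continuous_const.add (continuous_primitive_leb ((integrable_mv i2 _).add i1).neg)

/-- The source terms of two states that differ by the deterministic process `z`. -/
theorem source_diff [IsProbabilityMeasure P] {x x' : Time d.T → Ω → E n}
    {m m' z : Time d.T → E n} (hx : ∀ t, MemLp (x t) 2 P)
    (h : ∀ᵐ ω ∂P, ∀ t, x' t ω = x t ω + z t) (hm : m' = m + z) (t : Time d.T) :
    ∫ ω, x' t ω ∂P = ∫ ω, x t ω ∂P + z t ∧
    source d P x' m' t = source d P x m t + mv d.Qhat (z t) := by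
  have h1 : ∫ ω, x' t ω ∂P = ∫ ω, x t ω ∂P + z t := by
    have h2 : ∫ ω, x' t ω ∂P = ∫ ω, (x t ω + z t) ∂P :=
      integral_congr_ae (by filter_upwards [h] with ω hω; exact hω t)
    rw [h2, integral_add ((hx t).integrable (by norm_num)) (integrable_const _)]
    simp
  refine ⟨h1, ?_⟩
  have h3 : mv (1 - d.Γ) (z t) = z t - mv d.Γ (z t) := by
    simp [mv, Matrix.toLpLin_one]
  rw [source, source, h1, hm, Params.Qhat, mv_mul _ (1 - d.Γ), h3, ← mv_add, Pi.add_apply, mv_add]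
  congr 1
  abel

end States

/-! ### The costs as quadratic functionals of the disturbance. -/

section Costs

variable {Ω : Type*} [mΩ : MeasurableSpace Ω] {n n₁ n₂ N : ℕ} {d : Params n n₁ n₂}
  {𝓕 : Filtration (Time d.T) mΩ} {P : Measure Ω}

theorem integrable_inner_of_memLp {α : Type*} [MeasurableSpace α] {μ : Measure α} {k : ℕ}
    {v w : α → E k} (hv : MemLp v 2 μ) (hw : MemLp w 2 μ) :
    Integrable (fun a => inner ℝ (v a) (w a)) μ := by
  refine Integrable.mono' (hv.norm.integrable_mul hw.norm)
    (hv.aestronglyMeasurable.inner hw.aestronglyMeasurable)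
    (Eventually.of_forall fun a => norm_inner_le_norm _ _)

theorem integrable_qf {α : Type*} [MeasurableSpace α] {μ : Measure α} {k : ℕ}
    {v : α → E k} (hv : MemLp v 2 μ) (M : Matrix (Fin k) (Fin k) ℝ) :
    Integrable (fun a => qf M (v a)) μ :=
  integrable_inner_of_memLp hv (memLp_mv hv M)

/-- The quadratic form of a random vector shifted by a constant vector, in mean. -/
theorem integral_qf_add [IsProbabilityMeasure P] {k : ℕ} {M : Matrix (Fin k) (Fin k) ℝ}
    (hM : M.PosSemidef) {v : Ω → E k} (hv : MemLp v 2 P) (w : E k) :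
    ∫ ω, qf M (v ω + w) ∂P =
      ∫ ω, qf M (v ω) ∂P + 2 * inner ℝ w (mv M (∫ ω, v ω ∂P)) + qf M w := by
  have iv : Integrable v P := hv.integrable (by norm_num)
  -- As the shift is deterministic, the cross term sees `v` only through its mean; hence `𝔼 x` in
  -- the adjoint equation.
  have e1 : ∫ ω, inner ℝ w (mv M (v ω)) ∂P = inner ℝ w (mv M (∫ ω, v ω ∂P)) := by
    rw [integral_inner (integrable_mv iv M)]
    congr 1
    exact (mvL M).integral_comp_comm iv
  have i1 : Integrable (fun ω => 2 * inner ℝ w (mv M (v ω))) P :=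
    (integrable_inner_of_memLp (memLp_const w) (memLp_mv hv M)).const_mul 2
  have i01 : Integrable (fun ω => qf M (v ω) + 2 * inner ℝ w (mv M (v ω))) P :=
    (integrable_qf hv M).add i1
  simp_rw [qf_add hM]
  rw [integral_add i01 (integrable_const _),
    integral_add (integrable_qf hv M) i1, integral_const_mul, e1]
  simp

/-- The expectation of the running costs, with the time integral outside. -/
theorem integral_integral_qf_add [IsProbabilityMeasure P] {T : ℝ} {k : ℕ}
    {M : Matrix (Fin k) (Fin k) ℝ}
    (hM : M.PosSemidef) {v : Time T → Ω → E k}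
    (hv : MemLp (fun z : Ω × Time T => v z.2 z.1) 2 (P.prod (leb T)))
    (hvt : ∀ t, MemLp (v t) 2 P) {w : Time T → E k} (hw : Continuous w) :
    ∫ z : Ω × Time T, qf M (v z.2 z.1 + w z.2) ∂(P.prod (leb T)) =
      ∫ z : Ω × Time T, qf M (v z.2 z.1) ∂(P.prod (leb T)) +
      2 * ∫ t, inner ℝ (w t) (mv M (∫ ω, v t ω ∂P)) ∂(leb T) + ∫ t, qf M (w t) ∂(leb T) := by
  have hw2 : MemLp (fun z : Ω × Time T => w z.2) 2 (P.prod (leb T)) :=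
    (memLp_of_continuous hw).comp_snd P
  have i0 := integrable_qf hv M
  have i2 : Integrable (fun z : Ω × Time T => inner ℝ (w z.2) (mv M (v z.2 z.1)))
    (P.prod (leb T)) := integrable_inner_of_memLp hw2 (memLp_mv hv M)
  have e2 : ∫ z : Ω × Time T, inner ℝ (w z.2) (mv M (v z.2 z.1)) ∂(P.prod (leb T)) =
      ∫ t, inner ℝ (w t) (mv M (∫ ω, v t ω ∂P)) ∂(leb T) := by
    rw [integral_prod_symm _ i2]
    refine integral_congr_ae (Eventually.of_forall fun t => ?_)
    have iv : Integrable (v t) P := (hvt t).integrable (by norm_num)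
    simp only
    rw [integral_inner (integrable_mv iv M)]
    congr 1
    exact (mvL M).integral_comp_comm iv
  have e3 : ∫ z : Ω × Time T, qf M (w z.2) ∂(P.prod (leb T)) = ∫ t, qf M (w t) ∂(leb T) := by
    rw [integral_prod _ (integrable_qf hw2 M)]
    simp
  have i02 : Integrable (fun z : Ω × Time T =>
      qf M (v z.2 z.1) + 2 * inner ℝ (w z.2) (mv M (v z.2 z.1))) (P.prod (leb T)) :=
    i0.add (i2.const_mul 2)
  simp_rw [qf_add hM]
  rw [integral_add i02 (integrable_qf hw2 M),
    integral_add i0 (i2.const_mul 2), integral_const_mul, e2, e3]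

/-- The tracking error `x - (Γ m + η)`. -/
noncomputable def track (d : Params n n₁ n₂) (x : Time d.T → Ω → E n) (m : Time d.T → E n)
    (t : Time d.T) (ω : Ω) : E n := x t ω - (mv d.Γ (m t) + d.η)

theorem memLp_track [IsProbabilityMeasure P] {x : Time d.T → Ω → E n} {m : Time d.T → E n}
    (hx : IsL2Process 𝓕 P x) (hm : MemLp m 2 (leb d.T)) :
    MemLp (fun z : Ω × Time d.T => track d x m z.2 z.1) 2 (P.prod (leb d.T)) :=
  (hx.memLp d.le_last).sub ((memLp_mv (hm.comp_snd P) _).add (memLp_const _))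

theorem state_spec [IsProbabilityMeasure P] [P.IsComplete] {W : Fin N → Time d.T → Ω → E n₂}
    (hW : ∀ j, IsStandardBrownian (W j) P)
    (h𝓕 : 𝓕 = brownianFiltration W P (fun j => (hW j).measurable)) (i : Fin N) (x₀ : E n)
    {ubar : Time d.T → E n₁} (hubar : Continuous ubar) {u : Time d.T → Ω → E n₁}
    (hu : IsL2Process 𝓕 P u) (f : L2 d.T n) :
    IsState d 𝓕 P (W i) x₀ ubar u f (state d 𝓕 P (W i) x₀ ubar u f).1
      (state d 𝓕 P (W i) x₀ ubar u f).2 := by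
  obtain ⟨x, m, h, _⟩ := exists_isState hW h𝓕 i x₀ hubar hu (Lp.stronglyMeasurable f) (Lp.memLp f)
  exact Classical.epsilon_spec (p := fun xm : (Time d.T → Ω → E n) × (Time d.T → E n) =>
    IsState d 𝓕 P (W i) x₀ ubar u f xm.1 xm.2) ⟨(x, m), h⟩

theorem J'_eq [IsProbabilityMeasure P] {W : Time d.T → Ω → E n₂}
    {x₀ : E n} {ubar : Time d.T → E n₁} {u : Time d.T → Ω → E n₁}
    {f : L2 d.T n} (h : IsState d 𝓕 P W x₀ ubar u f (state d 𝓕 P W x₀ ubar u f).1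
      (state d 𝓕 P W x₀ ubar u f).2) :
    J' d 𝓕 P W x₀ ubar u f = -(∫ z : Ω × Time d.T, qf d.Q (track d (state d 𝓕 P W x₀ ubar u f).1
      (state d 𝓕 P W x₀ ubar u f).2 z.2 z.1) ∂(P.prod (leb d.T))) + 1 / d.γ * inner ℝ f f
      - ∫ ω, qf d.H ((state d 𝓕 P W x₀ ubar u f).1 d.last ω) ∂P := by
  have i1 := integrable_qf (memLp_track h.x_mem h.m_mem) d.Q
  have i2 : Integrable (fun z : Ω × Time d.T => 1 / d.γ * ‖f z.2‖ ^ 2) (P.prod (leb d.T)) :=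
    ((integrable_norm_sq_L2 f).comp_snd P).const_mul _
  have e := integral_prod _ (i1.neg.add i2)
  have e2 : ∫ z : Ω × Time d.T, 1 / d.γ * ‖f z.2‖ ^ 2 ∂(P.prod (leb d.T)) =
      1 / d.γ * inner ℝ f f := by
    rw [integral_prod _ i2]
    simp [integral_const_mul, inner_L2_self]
  rw [integral_add' i1.neg i2, e2, integral_neg'] at e
  rw [e]
  rfl

/-- Everything cancels except the control energy, which does not depend on `f`. -/
theorem J_add_J' [IsProbabilityMeasure P] {W : Time d.T → Ω → E n₂}
    {x₀ : E n} {ubar : Time d.T → E n₁} {u : Time d.T → Ω → E n₁} (hu : IsL2Process 𝓕 P u)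
    {f : L2 d.T n} (h : IsState d 𝓕 P W x₀ ubar u f (state d 𝓕 P W x₀ ubar u f).1
      (state d 𝓕 P W x₀ ubar u f).2) :
    J d 𝓕 P W x₀ ubar u f + J' d 𝓕 P W x₀ ubar u f =
      ∫ z : Ω × Time d.T, qf d.R (u z.2 z.1) ∂(P.prod (leb d.T)) := by
  have i1 := integrable_qf (memLp_track h.x_mem h.m_mem) d.Q
  have i2 : Integrable (fun z : Ω × Time d.T => 1 / d.γ * ‖f z.2‖ ^ 2) (P.prod (leb d.T)) :=
    ((integrable_norm_sq_L2 f).comp_snd P).const_mul _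
  have i3 := integrable_qf (hu.memLp d.le_last) d.R
  have e := integral_prod _ (i1.neg.add i2)
  have e' := integral_prod _ ((i1.add i3).sub i2)
  rw [integral_add' i1.neg i2, integral_neg'] at e
  rw [integral_sub' (i1.add i3) i2, integral_add' i1 i3] at e'
  have hJ : J d 𝓕 P W x₀ ubar u f = _ + ∫ ω, qf d.H ((state d 𝓕 P W x₀ ubar u f).1 d.last ω) ∂P :=
    congrArg (· + ∫ ω, qf d.H ((state d 𝓕 P W x₀ ubar u f).1 d.last ω) ∂P) e'.symm
  have hJ' : J' d 𝓕 P W x₀ ubar u f = _ - ∫ ω, qf d.H ((state d 𝓕 P W x₀ ubar u f).1 d.last ω) ∂P :=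
    congrArg (· - ∫ ω, qf d.H ((state d 𝓕 P W x₀ ubar u f).1 d.last ω) ∂P) e.symm
  rw [hJ, hJ']
  ring

/-- The cost `J'` is a quadratic functional with Hessian `hess d` and linear part given by the
adjoint state `p` of the reference state `(x, m)`. -/
theorem exists_J'_quadratic [IsProbabilityMeasure P] [P.IsComplete]
    {W : Fin N → Time d.T → Ω → E n₂} (hW : ∀ j, IsStandardBrownian (W j) P)
    (h𝓕 : 𝓕 = brownianFiltration W P (fun j => (hW j).measurable)) (i : Fin N) (x₀ : E n)
    {ubar : Time d.T → E n₁} (hubar : Continuous ubar) {u : Time d.T → Ω → E n₁}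
    (hu : IsL2Process 𝓕 P u) {x : Time d.T → Ω → E n} {m : Time d.T → E n}
    (h : IsState d 𝓕 P (W i) x₀ ubar u (0 : L2 d.T n) x m) (b : L2 d.T n)
    (hb : ∀ f : L2 d.T n, inner ℝ b f =
      inner ℝ (auxState d f d.last) (mv d.H (∫ ω, x d.last ω ∂P)) +
        ∫ t, inner ℝ (auxState d f t) (source d P x m t) ∂(leb d.T)) :
    ∃ c : ℝ, ∀ f, J' d 𝓕 P (W i) x₀ ubar u f =
      inner ℝ (hess d f) f - 2 * inner ℝ b f + c := by
  refine ⟨-(∫ z : Ω × Time d.T, qf d.Q (track d x m z.2 z.1) ∂(P.prod (leb d.T)))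
    - ∫ ω, qf d.H (x d.last ω) ∂P, fun f => ?_⟩
  have hs := state_spec hW h𝓕 i x₀ hubar hu f
  rw [J'_eq hs]
  set x' := (state d 𝓕 P (W i) x₀ ubar u f).1
  set m' := (state d 𝓕 P (W i) x₀ ubar u f).2
  set z := auxState d f with hz
  have hzc : Continuous z := continuous_auxState d f
  have hzc' : Continuous fun t => mv (1 - d.Γ) (z t) := (continuous_mv _).comp hzc
  have hxt := h.memLp_apply (hW i) hubar hu (Lp.stronglyMeasurable _) (Lp.memLp _)
  obtain ⟨hx', hm'⟩ := h.diff hubar hu (integrable_L2 _) (integrable_L2 f) hs (g := f) (by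
    filter_upwards [Lp.coeFn_zero (E n) 2 (leb d.T)] with t ht
    rw [ht]
    simp)
  have htr : ∀ᵐ a ∂(P.prod (leb d.T)), track d x' m' a.2 a.1 =
      track d x m a.2 a.1 + mv (1 - d.Γ) (z a.2) := by
    have h1 : ∀ᵐ a ∂(P.prod (leb d.T)), ∀ t, x' t a.1 = x t a.1 + z t :=
      Measure.quasiMeasurePreserving_fst.ae hx'
    filter_upwards [h1] with a ha
    have h3 : mv (1 - d.Γ) (z a.2) = z a.2 - mv d.Γ (z a.2) := by
      simp [mv, Matrix.toLpLin_one]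
    rw [track, track, ha, hm', h3, Pi.add_apply, mv_add]
    abel
  have htt (t : Time d.T) : MemLp (track d x m t) 2 P :=
    (hxt t).sub (memLp_const _)
  have e1 : ∫ a : Ω × Time d.T, qf d.Q (track d x' m' a.2 a.1) ∂(P.prod (leb d.T)) = _ :=
    (integral_congr_ae (by filter_upwards [htr] with a ha; rw [ha])).trans
      (integral_integral_qf_add d.Q_psd (memLp_track h.x_mem h.m_mem) htt hzc')
  have e2 : ∫ ω, qf d.H (x' d.last ω) ∂P = _ :=
    (integral_congr_ae (by filter_upwards [hx'] with ω hω; rw [hω])).trans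
      (integral_qf_add d.H_psd (hxt d.last) (z d.last))
  -- Moving `I - Γ` to the other side turns the cross term into the source of the adjoint equation.
  have e3 (t : Time d.T) : inner ℝ (mv (1 - d.Γ) (z t)) (mv d.Q (∫ ω, track d x m t ω ∂P)) =
      inner ℝ (z t) (source d P x m t) := by
    have : ∫ ω, track d x m t ω ∂P = ∫ ω, x t ω ∂P - (mv d.Γ (m t) + d.η) := by
      simp only [track]
      rw [integral_sub ((hxt t).integrable (by norm_num)) (integrable_const _)]
      simp
    rw [this, source, mv_mul, real_inner_comm, ← inner_mv_transpose, real_inner_comm]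
  simp_rw [e3, ← qf_sandwich] at e1
  rw [e1, e2, hb, inner_hess]
  simp only [qf, real_inner_comm, Params.Qhat, hz]
  ring

end Costs

/-! ### The forward-backward system: uniqueness, and existence from a critical point. -/

section Optimality

variable {Ω : Type*} [mΩ : MeasurableSpace Ω] {n n₁ n₂ N : ℕ} {d : Params n n₁ n₂}
  {𝓕 : Filtration (Time d.T) mΩ} {P : Measure Ω}

theorem integral_inner_toLp {T : ℝ} {k : ℕ} (g : L2 T k) {p : Time T → E k} (hp : Continuous p) :
    ∫ t, inner ℝ (g t) (p t) ∂(leb T) = inner ℝ ((memLp_of_continuous hp).toLp p) g := by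
  rw [L2.inner_def]
  refine integral_congr_ae ?_
  filter_upwards [(memLp_of_continuous hp).coeFn_toLp] with t ht
  rw [ht, real_inner_comm]

theorem auxState_zero : auxState d 0 = 0 := by
  simpa using auxState_smul d 0 0

/-- Two solutions of the forward-backward system coincide. -/
theorem IsSolution.unique [IsProbabilityMeasure P] {W : Time d.T → Ω → E n₂}
    (hW : IsStandardBrownian W P) {x₀ : E n}
    {ubar : Time d.T → E n₁} (hubar : Continuous ubar) {u : Time d.T → Ω → E n₁}
    (hu : IsL2Process 𝓕 P u) {ε₀ : ℝ} (hH1 : H1 d ε₀) {x x' : Time d.T → Ω → E n}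
    {m m' p p' : Time d.T → E n} (h : IsSolution d 𝓕 P W x₀ ubar u x m p)
    (h' : IsSolution d 𝓕 P W x₀ ubar u x' m' p') :
    (∀ᵐ ω ∂P, ∀ t, x' t ω = x t ω) ∧ m' = m ∧ p' = p := by
  have hpc := h.continuous_p
  have hpc' := h'.continuous_p
  have hqc : Continuous fun t => p' t - p t := hpc'.sub hpc
  have hgc : Continuous fun t => d.γ • (p' t - p t) := hqc.const_smul d.γ
  set g := (memLp_of_continuous hgc).toLp _ with hg
  have hgae : g =ᵐ[leb d.T] fun t => d.γ • (p' t - p t) := (memLp_of_continuous hgc).coeFn_toLp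
  have hpγ : Continuous fun t => d.γ • p t := hpc.const_smul d.γ
  have hpγ' : Continuous fun t => d.γ • p' t := hpc'.const_smul d.γ
  obtain ⟨hx, hm⟩ := h.isState.diff hubar hu (integrable_leb_of_continuous hpγ)
    (integrable_leb_of_continuous hpγ') h'.isState (g := g) (by
      filter_upwards [hgae] with t ht
      rw [ht, smul_sub])
  have hxt := h.isState.memLp_apply hW hubar hu hpγ.stronglyMeasurable (memLp_of_continuous hpγ)
  have hsrc := source_diff hxt hx hm
  have hzc := continuous_auxState d g
  have hQz : Continuous fun t => mv d.Qhat (auxState d g t) := (continuous_mv _).comp hzc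
  -- The difference of the adjoints solves the homogeneous adjoint problem along `z = auxState d g`,
  -- with terminal value `H z(T)`.
  have hq (t : Time d.T) : p' t - p t = mv d.H (auxState d g d.last) + ∫ s in Ici t,
      (mv (d.A + d.G).transpose (p' s - p s) + mv d.Qhat (auxState d g s)) ∂(leb d.T) := by
    have i1 : Integrable (fun s => mv (d.A + d.G).transpose (p s) + source d P x m s) (leb d.T) :=
      (integrable_mv (integrable_leb_of_continuous hpc) _).add (integrable_source h.x_mem h.m_mem)
    have i2 : Integrable (fun s => mv (d.A + d.G).transpose (p' s) + source d P x' m' s)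
        (leb d.T) :=
      (integrable_mv (integrable_leb_of_continuous hpc') _).add
        (integrable_source h'.x_mem h'.m_mem)
    have e1 : p t = mv d.H (∫ ω, x d.last ω ∂P) + ∫ s in Ici t,
      (mv (d.A + d.G).transpose (p s) + source d P x m s) ∂(leb d.T) := h.p_eq t
    have e2 : p' t = mv d.H (∫ ω, x' d.last ω ∂P) + ∫ s in Ici t,
      (mv (d.A + d.G).transpose (p' s) + source d P x' m' s) ∂(leb d.T) := h'.p_eq t
    have e3 : ∫ s in Ici t, (mv (d.A + d.G).transpose (p' s - p s) + mv d.Qhat (auxState d g s))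
        ∂(leb d.T) = ∫ s in Ici t, ((mv (d.A + d.G).transpose (p' s) + source d P x' m' s) -
          (mv (d.A + d.G).transpose (p s) + source d P x m s)) ∂(leb d.T) := by
      refine integral_congr_ae (Eventually.of_forall fun s => ?_)
      simp only [(hsrc s).2, mv_sub]
      abel
    rw [e3, integral_sub i2.restrict i1.restrict, e1, e2, (hsrc d.last).1, mv_add]
    abel
  have hdual := inner_dual d.le_last hqc (integrable_leb_of_continuous hQz) hzc (integrable_L2 g)
    hq (auxState_eq d g)
  have hγ := d.γ_pos
  have e4 : ∫ t, inner ℝ (g t) (p' t - p t) ∂(leb d.T) = 1 / d.γ * inner ℝ g g := by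
    rw [L2.inner_def, ← integral_const_mul]
    refine integral_congr_ae ?_
    filter_upwards [hgae] with t ht
    rw [ht, inner_smul_right (𝕜 := ℝ) (d.γ • (p' t - p t)), one_div, inv_mul_cancel_left₀ hγ.ne']
  have hh := hess_coercive d hH1 g
  rw [inner_hess] at hh
  rw [e4] at hdual
  simp only [real_inner_comm (auxState d g _)] at hh
  -- Duality reads `⟪z(T), H z(T)⟫ + ∫ ⟪z, Qhat z⟫ = γ⁻¹ ‖g‖²`, so the Hessian form vanishes at `g`.
  have h0 : ε₀ * ‖g‖ ^ 2 ≤ 0 := by linarith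
  have hg0 : g = 0 := by
    have : ‖g‖ ^ 2 ≤ 0 := nonpos_of_mul_nonpos_right h0 hH1.1
    have : ‖g‖ = 0 := by
      rw [← sq_eq_zero_iff]
      exact le_antisymm this (by positivity)
    exact norm_eq_zero.1 this
  have hz0 (t : Time d.T) : auxState d g t = 0 := by
    rw [hg0, auxState_zero]
    rfl
  have hq0 : ∀ᵐ t ∂(leb d.T), p' t - p t = 0 := by
    rw [hg0] at hgae
    filter_upwards [hgae, Lp.coeFn_zero (E n) 2 (leb d.T)] with t h1 h2
    rw [h2] at h1
    exact (smul_eq_zero.1 h1.symm).resolve_left hγ.ne'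
  refine ⟨?_, ?_, ?_⟩
  · filter_upwards [hx] with ω hω t
    rw [hω, hz0, add_zero]
  · rw [hm, hg0, auxState_zero, add_zero]
  · funext t
    -- Equality of the adjoints is known almost everywhere; the integral equation upgrades it to
    -- every `t`.
    rw [← sub_eq_zero, hq t, hz0, mv_zero, zero_add]
    refine (integral_congr_ae (ae_restrict_of_ae ?_)).trans (integral_zero _ _)
    filter_upwards [hq0] with s hs
    rw [hs, hz0, mv_zero, mv_zero, add_zero]

/-- A critical point of the cost gives a solution of the forward-backward system. -/
theorem exists_isSolution [IsProbabilityMeasure P] {W : Time d.T → Ω → E n₂}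
    (hW : IsStandardBrownian W P) {x₀ : E n}
    {ubar : Time d.T → E n₁} (hubar : Continuous ubar) {u : Time d.T → Ω → E n₁}
    (hu : IsL2Process 𝓕 P u) {x x' : Time d.T → Ω → E n} {m m' : Time d.T → E n}
    (h : IsState d 𝓕 P W x₀ ubar u (0 : L2 d.T n) x m) {b f : L2 d.T n}
    (hb : ∀ f : L2 d.T n, inner ℝ b f =
      inner ℝ (auxState d f d.last) (mv d.H (∫ ω, x d.last ω ∂P)) +
        ∫ t, inner ℝ (auxState d f t) (source d P x m t) ∂(leb d.T))
    (h' : IsState d 𝓕 P W x₀ ubar u f x' m') (hf : hess d f = b) :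
    ∃ p, IsSolution d 𝓕 P W x₀ ubar u x' m' p ∧ f =ᵐ[leb d.T] fun t => d.γ • p t := by
  have hxt := h.memLp_apply hW hubar hu (Lp.stronglyMeasurable _) (Lp.memLp _)
  obtain ⟨hx, hm⟩ := h.diff hubar hu (integrable_L2 _) (integrable_L2 f) h' (g := f) (by
    filter_upwards [Lp.coeFn_zero (E n) 2 (leb d.T)] with t ht
    rw [ht]
    simp)
  have hsrc := source_diff hxt hx hm
  have is := integrable_source h.x_mem h.m_mem
  have is' := integrable_source h'.x_mem h'.m_mem
  have hQz : Continuous fun t => mv d.Qhat (auxState d f t) :=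
    (continuous_mv _).comp (continuous_auxState d f)
  -- The adjoint is taken along the state driven by `f` itself, so its equation holds by
  -- construction and only `f = γ p` remains.
  obtain ⟨p, hpc, hp⟩ := exists_dual (d.A + d.G) (mv d.H (∫ ω, x' d.last ω ∂P)) d.le_last is'
  have hγ := d.γ_pos
  -- Tested against `g`, duality gives `⟪p, g⟫ = ⟪b, g⟫` plus the `Qhat` and `H` terms that `hess d`
  -- subtracts; with `hess d f = b` only `γ⁻¹ ⟪f, g⟫` is left.
  have hpf : (memLp_of_continuous hpc).toLp p = (1 / d.γ) • f := by
    refine ext_inner_right ℝ fun g => ?_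
    have hzc := continuous_auxState d g
    have i1 : Integrable (fun t => inner ℝ (auxState d g t) (source d P x m t)) (leb d.T) := by
      simp_rw [real_inner_comm (source d P x m _)]
      exact bilin_integrable (innerB n) is hzc
    have i2 : Integrable (fun t => inner ℝ (auxState d g t) (mv d.Qhat (auxState d f t)))
        (leb d.T) := integrable_leb_of_continuous (hzc.inner hQz)
    have hdual := inner_dual d.le_last hpc is' hzc (integrable_L2 g) hp (auxState_eq d g)
    have hbg := hb g
    rw [← hf, inner_hess] at hbg
    simp only [(hsrc _).2, (hsrc d.last).1, inner_add_right, mv_add] at hdual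
    rw [integral_add i1 i2, integral_inner_toLp g hpc] at hdual
    rw [← hdual, inner_smul_left, conj_trivial]
    simp only [real_inner_comm (auxState d g _)] at hbg ⊢
    linarith
  have hfp : f =ᵐ[leb d.T] fun t => d.γ • p t := by
    have h1 : f = d.γ • (memLp_of_continuous hpc).toLp p := by
      rw [hpf, smul_smul, mul_one_div_cancel hγ.ne', one_smul]
    have h2 := Lp.coeFn_smul d.γ ((memLp_of_continuous hpc).toLp p)
    rw [← h1] at h2
    filter_upwards [h2, (memLp_of_continuous hpc).coeFn_toLp] with t h3 h4
    rw [h3, Pi.smul_apply, h4]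
  have hs := h'.congr hfp
  exact ⟨p, ⟨hs.x_mem, hs.m_mem, memLp_of_continuous hpc, hs.x_eq, hs.m_eq, hp⟩, hfp⟩

end Optimality

end RobustLQG

/-! ### Assembly of the theorem. -/

theorem mainTheorem5 {n n₁ n₂ N : ℕ} (d : RobustLQG.Params n n₁ n₂)
    {Ω : Type*} [MeasurableSpace Ω] (P : Measure Ω) [IsProbabilityMeasure P] [P.IsComplete]
    (W : Fin N → RobustLQG.Time d.T → Ω → RobustLQG.E n₂) (hW : RobustLQG.IsBrownianFamily W P)
    (𝓕 : Filtration (RobustLQG.Time d.T) ‹MeasurableSpace Ω›)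
    (h𝓕 : 𝓕 = RobustLQG.brownianFiltration W P (fun j => (hW.brownian j).measurable))
    (i : Fin N) (x₀ : RobustLQG.E n)
    (u : RobustLQG.Time d.T → Ω → RobustLQG.E n₁) (hu : RobustLQG.IsL2Process 𝓕 P u)
    (ubar : RobustLQG.Time d.T → RobustLQG.E n₁) (hubar : Continuous ubar)
    (ε₀ : ℝ) (hH1 : RobustLQG.H1 d ε₀) :
    -- the limiting model is well posed, so that the costs are those of its unique solution
    (∀ f : RobustLQG.L2 d.T n, ∃ x m, RobustLQG.IsState d 𝓕 P (W i) x₀ ubar u f x m ∧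
      ∀ x' m', RobustLQG.IsState d 𝓕 P (W i) x₀ ubar u f x' m' →
        (∀ᵐ ω ∂P, ∀ t, x' t ω = x t ω) ∧ m' = m) ∧
    -- strict convexity / concavity
    StrictConvexOn ℝ univ (RobustLQG.J' d 𝓕 P (W i) x₀ ubar u) ∧
    StrictConcaveOn ℝ univ (RobustLQG.J d 𝓕 P (W i) x₀ ubar u) ∧
    -- coercivity
    (∃ C : ℝ, ∀ f, ε₀ / 2 * ‖f‖ ^ 2 - C ≤ RobustLQG.J' d 𝓕 P (W i) x₀ ubar u f) ∧
    (∃ C : ℝ, ∀ f, RobustLQG.J d 𝓕 P (W i) x₀ ubar u f ≤ C - ε₀ / 2 * ‖f‖ ^ 2) ∧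
    -- unique optimal disturbance and its characterization by the forward-backward system
    ∃ fhat : RobustLQG.L2 d.T n,
      (∀ f, IsMinOn (RobustLQG.J' d 𝓕 P (W i) x₀ ubar u) univ f ↔ f = fhat) ∧
      (∀ f, IsMaxOn (RobustLQG.J d 𝓕 P (W i) x₀ ubar u) univ f ↔ f = fhat) ∧
      ∃ x m p, RobustLQG.IsSolution d 𝓕 P (W i) x₀ ubar u x m p ∧
        (∀ x' m' p', RobustLQG.IsSolution d 𝓕 P (W i) x₀ ubar u x' m' p' →
          (∀ᵐ ω ∂P, ∀ t, x' t ω = x t ω) ∧ m' = m ∧ p' = p) ∧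
        fhat =ᵐ[RobustLQG.leb d.T] fun t => d.γ • p t := by
  have hB := hW.brownian
  have hst := RobustLQG.state_spec hB h𝓕 i x₀ hubar hu
  have hJJ := fun f => RobustLQG.J_add_J' hu (hst f)
  have h0 := hst 0
  set x := (RobustLQG.state d 𝓕 P (W i) x₀ ubar u 0).1
  set m := (RobustLQG.state d 𝓕 P (W i) x₀ ubar u 0).2
  have hsrc := RobustLQG.integrable_source h0.x_mem h0.m_mem
  -- The adjoint of the undisturbed state is the Riesz representative of the linear part of `J'`, up
  -- to the factor `-2`.
  obtain ⟨p₀, hpc, hp₀⟩ := RobustLQG.exists_dual (d.A + d.G)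
    (RobustLQG.mv d.H (∫ ω, x d.last ω ∂P)) d.le_last hsrc
  obtain ⟨b, hbdef⟩ : ∃ b, b = (RobustLQG.memLp_of_continuous hpc).toLp p₀ := ⟨_, rfl⟩
  have hb (f : RobustLQG.L2 d.T n) : inner ℝ b f =
      inner ℝ (RobustLQG.auxState d f d.last) (RobustLQG.mv d.H (∫ ω, x d.last ω ∂P)) +
        ∫ t, inner ℝ (RobustLQG.auxState d f t) (RobustLQG.source d P x m t)
          ∂(RobustLQG.leb d.T) := by
    rw [RobustLQG.inner_dual d.le_last hpc hsrc (RobustLQG.continuous_auxState d f)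
      (RobustLQG.integrable_L2 f) hp₀ (RobustLQG.auxState_eq d f),
      RobustLQG.integral_inner_toLp f hpc, hbdef]
  obtain ⟨c, hc⟩ := RobustLQG.exists_J'_quadratic hB h𝓕 i x₀ hubar hu h0 b hb
  set K := ∫ z : Ω × RobustLQG.Time d.T, RobustLQG.qf d.R (u z.2 z.1)
    ∂(P.prod (RobustLQG.leb d.T))
  have hJ : RobustLQG.J d 𝓕 P (W i) x₀ ubar u =
      fun f => K - RobustLQG.J' d 𝓕 P (W i) x₀ ubar u f :=
    funext fun f => eq_sub_of_add_eq (hJJ f)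
  have hsym := RobustLQG.hess_symm d
  have hco := RobustLQG.hess_coercive d hH1
  have hconv := RobustLQG.quadratic_strictConvexOn _ hsym b c hc hH1.1 hco
  obtain ⟨C, hC⟩ := RobustLQG.quadratic_coercive _ b c hc hH1.1 hco
  obtain ⟨fhat, hcrit, hmin⟩ := RobustLQG.quadratic_exists_min _ hsym b c hc hH1.1 hco
  obtain ⟨p, hsol, hfp⟩ := RobustLQG.exists_isSolution (hB i) hubar hu h0 hb (hst fhat) hcrit
  refine ⟨fun f => ⟨_, _, hst f, fun x' m' h' => ?_⟩, hconv, ?_, ⟨C, hC⟩,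
    ⟨K + C, fun f => ?_⟩, fhat, hmin, fun f => ?_, _, _, p, hsol,
    fun x' m' p' h' => hsol.unique (hB i) hubar hu hH1 h', hfp⟩
  -- Uniqueness of the state is the difference formula with equal disturbances, where the shift is
  -- zero.
  · obtain ⟨h1, h2⟩ := (hst f).diff hubar hu (RobustLQG.integrable_L2 f)
      (RobustLQG.integrable_L2 f) h' (g := 0) (by
        filter_upwards [Lp.coeFn_zero (RobustLQG.E n) 2 (RobustLQG.leb d.T)] with t ht
        rw [ht]
        simp)
    rw [RobustLQG.auxState_zero] at h1 h2
    refine ⟨?_, h2.trans (add_zero _)⟩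
    filter_upwards [h1] with ω hω t
    exact (hω t).trans (add_zero _)
  · rw [hJ]
    simp_rw [sub_eq_add_neg]
    exact (hconv.neg.add_const K).congr fun f _ => by simp [add_comm]
  · have := hC f
    rw [hJ]
    simp only
    linarith
  · rw [← hmin f, isMinOn_iff, isMaxOn_iff, hJ]
    simp only [sub_le_sub_iff_left]
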